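/- For a bounded open set $\Omega\subset\mathbb R^2$ (not necessarily connected) let $-\Delta_\Omega$ be the Dirichlet Laplacian on $L^2(\Omega)$, with eigenvalues $\lambda_1(\Omega)\le\lambda_2(\Omega)\le\dots$ repeated according to multiplicity, and let $Q_\Omega(t)=\int_\Omega u(x,t)\,dx$, $t>0$, be its heat content, where $u$ is the unique solution of $\partial_t u=\Delta u$ on $\Omega$ for $t>0$ with Dirichlet boundary conditions and $u(\cdot,t)\to 1$ in $L^2(\Omega)$ as $t\downarrow 0$. Two such sets $\Omega_1,\Omega_2$ are isospectral if $\lambda_j(\Omega_1)=\lambda_j(\Omega_2)$ for all $j$, and isoheat if $Q_{\Omega_1}(t)=Q_{\Omega_2}(t)$ for all $t>0$. Let $A$ be a disjoint union of an open unit square and an open right isosceles triangle of area $2$, and let $B$ be a disjoint union of an open $1\times 2$ rectangle and an open right isosceles triangle of area $1$ (Chapman's two-piece bands). Then $A$ and $B$ are isospectral but not isoheat. Moreover, as $t\to\infty$, $$Q_A(t)=\frac{1024}{9\pi^4}e^{-5\pi^2t/4}+O(e^{-2\pi^2t}),\qquad Q_B(t)=\frac{1152}{9\pi^4}e^{-5\pi^2t/4}+O(e^{-2\pi^2t}).$$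 -/

import Mathlib

open Real Set Filter Topology MeasureTheory Asymptotics
open scoped ContDiff ENNReal

noncomputable section

/-- The Euclidean plane. -/
abbrev Plane : Type := EuclideanSpace ℝ (Fin 2)

/-- The real Hilbert space `L²(Ω)` for the Lebesgue (area) measure. -/
abbrev L2 (Ω : Set Plane) : Type := Lp ℝ 2 ((volume : Measure Plane).restrict Ω)

/-- The Hilbert space of square integrable vector fields on `Ω`. -/
abbrev L2Field (Ω : Set Plane) : Type := Lp Plane 2 ((volume : Measure Plane).restrict Ω)

/-- `φ` belongs to `C_c^∞(Ω)`. -/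
def IsTestFunction (Ω : Set Plane) (φ : Plane → ℝ) : Prop :=
  ContDiff ℝ ∞ φ ∧ HasCompactSupport φ ∧ tsupport φ ⊆ Ω

/-- `u` belongs to `H¹₀(Ω)` (the closure of `C_c^∞(Ω)` in the `H¹` norm), and its gradient is `G`:
some sequence of test functions converges to `u` in `L²(Ω)` while its gradients converge to `G`. -/
def HasDirichletGradient (Ω : Set Plane) (u : L2 Ω) (G : L2Field Ω) : Prop :=
  ∃ φ : ℕ → Plane → ℝ, (∀ n, IsTestFunction Ω (φ n)) ∧
    Tendsto (fun n => eLpNorm (fun x => φ n x - u x) 2 (volume.restrict Ω)) atTop (𝓝 0) ∧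
    Tendsto (fun n => eLpNorm (fun x => gradient (φ n) x - G x) 2 (volume.restrict Ω)) atTop (𝓝 0)

/-- The graph of the Dirichlet Laplacian `-Δ_Ω` on `L²(Ω)` (the self-adjoint operator of the
Dirichlet form): `u` is in its domain and `-Δ_Ω u = f`. That is, `u ∈ H¹₀(Ω)`, and
`∫_Ω ∇u · ∇ψ = ∫_Ω f ψ` for all `ψ ∈ C_c^∞(Ω)`. -/
def IsNegDirichletLaplacian (Ω : Set Plane) (u f : L2 Ω) : Prop :=
  ∃ G : L2Field Ω, HasDirichletGradient Ω u G ∧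
    ∀ ψ : Plane → ℝ, IsTestFunction Ω ψ →
      ∫ x in Ω, inner ℝ (G x) (gradient ψ x) = ∫ x in Ω, f x * ψ x

/-- `ev 0 ≤ ev 1 ≤ …` is the sequence of the eigenvalues of `-Δ_Ω`, repeated according to
multiplicity: `-Δ_Ω` has discrete spectrum, and `L²(Ω)` has an orthonormal basis of eigenfunctions
with these eigenvalues. Since `-Δ_Ω` is symmetric, this determines `ev`. -/
def IsDirichletSpectrum (Ω : Set Plane) (ev : ℕ → ℝ) : Prop :=
  Monotone ev ∧ Tendsto ev atTop atTop ∧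
    ∃ φ : HilbertBasis ℕ ℝ (L2 Ω), ∀ j, IsNegDirichletLaplacian Ω (φ j) (ev j • φ j)

/-- The Dirichlet Laplacians of the two domains have the same eigenvalues, with multiplicities. -/
def Isospectral (Ω₁ Ω₂ : Set Plane) : Prop :=
  ∃ ev : ℕ → ℝ, IsDirichletSpectrum Ω₁ ev ∧ IsDirichletSpectrum Ω₂ ev

/-- `u` solves the heat equation `∂u/∂t = Δu` on `Ω` for `t > 0`, with Dirichlet boundary
conditions, and `u(·, t) → 1` in `L²(Ω)` as `t ↓ 0`. (Values at `t ≤ 0` play no role.) -/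
def IsHeatSolution (Ω : Set Plane) (u : ℝ → L2 Ω) : Prop :=
  (∀ t : ℝ, 0 < t → ∃ f : L2 Ω, IsNegDirichletLaplacian Ω (u t) f ∧ HasDerivAt u (-f) t) ∧
    Tendsto (fun t => eLpNorm (fun x => u t x - 1) 2 (volume.restrict Ω)) (𝓝[>] 0) (𝓝 0)

/-- The initial boundary value problem that defines the heat content has exactly one solution. -/
def HeatProblemWellPosed (Ω : Set Plane) : Prop :=
  (∃ u, IsHeatSolution Ω u) ∧
    ∀ u v, IsHeatSolution Ω u → IsHeatSolution Ω v → ∀ t : ℝ, 0 < t → u t = v t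

open Classical in
/-- The heat content `Q_Ω(t) = ∫_Ω u(x, t) dx`, for `t > 0`, where `u` is the solution of the heat
problem (a junk value is used if there is none). -/
def heatContent (Ω : Set Plane) (t : ℝ) : ℝ :=
  if h : ∃ u, IsHeatSolution Ω u then ∫ x in Ω, h.choose t x else 0

/-- The two domains have the same heat content at all times. -/
def Isoheat (Ω₁ Ω₂ : Set Plane) : Prop :=
  ∀ t : ℝ, 0 < t → heatContent Ω₁ t = heatContent Ω₂ t

/-- The open rectangle `(0, a) × (0, b)`. -/
def openRectangle (a b : ℝ) : Set Plane :=
  {x | 0 < x 0 ∧ x 0 < a ∧ 0 < x 1 ∧ x 1 < b}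

/-- The open right isosceles triangle with vertices `(0, 0)`, `(c, 0)`, `(c, c)`; its legs have
length `c` and its area is `c ^ 2 / 2`. -/
def openRightIsoscelesTriangle (c : ℝ) : Set Plane :=
  {x | 0 < x 1 ∧ x 1 < x 0 ∧ x 0 < c}

/-- `Ω` is the union of two disjoint pieces, congruent to `P₁` and `P₂`. -/
def IsTwoPieceBand (P₁ P₂ Ω : Set Plane) : Prop :=
  ∃ g₁ g₂ : Plane ≃ᵃⁱ[ℝ] Plane, Disjoint (g₁ '' P₁) (g₂ '' P₂) ∧ Ω = g₁ '' P₁ ∪ g₂ '' P₂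

/-- The band `A`: a unit square and a right isosceles triangle of area `2`. -/
def IsChapmanBandA (A : Set Plane) : Prop :=
  IsTwoPieceBand (openRectangle 1 1) (openRightIsoscelesTriangle 2) A

/-- The band `B`: a `1 × 2` rectangle and a right isosceles triangle of area `1`. -/
def IsChapmanBandB (B : Set Plane) : Prop :=
  IsTwoPieceBand (openRectangle 1 2) (openRightIsoscelesTriangle (√2)) B

end

noncomputable section

/-! ### Test functions and their gradients -/

/-! Both spectra are explicit. Separation of variables gives π²(m²/a² + n²/b²) with m, n ≥ 1 on an a
× b rectangle. On the right isosceles triangle with legs c, the modes of the square of side c that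
are antisymmetric about the diagonal give π²(p² + q²)/c² with p > q ≥ 1. Isospectrality is then
arithmetic (`bandIndexMap`): the square mode (m, n) matches the rectangle mode (m, 2n). A mode (p,
q) of the triangle with legs 2 matches the mode ((p+q)/2, (p-q)/2) of the triangle with legs √2 if p
and q have the same parity. Otherwise it matches the rectangle mode (k, j), where 2k is the even and
j the odd one of p, q.

Expanding 1 in the eigenbasis gives Q(t) = Σ exp(-λ_j t) (∫ φ_j)²
(`IsDirichletEigenbasis.hasSum_heatContent`). In both bands the lowest eigenvalue 5π²/4 is simple
and all others are at least 2π², so the leading coefficient is (∫ φ_1)². The ground state lives on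
the triangle of A but on the rectangle of B, and the two coefficients differ; hence so do the heat
contents.

The analytic work is to show that the explicit modes form a complete orthonormal family of
eigenfunctions of the operator defined by the Dirichlet form (`IsEigenfamily`). They lie in H¹₀
because they vanish linearly at every side, which makes cutoffs converge
(`exists_testFunction_approx_of_polygon`). The weak equation is integration by parts. Completeness
comes from Stone–Weierstrass: the span of the modes is stable under multiplication by cosine
polynomials that separate points (`ae_eq_zero_of_integral_mul_eq_zero`). Isometries and disjoint
unions preserve all this (`IsEigenfamily.image`, `exists_eigenbasis_union`). For the heat problem,
closedness of the graph of the Laplacian yields existence and its symmetry yields uniqueness. -/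

theorem norm_gradient_eq (f : Plane → ℝ) (x : Plane) : ‖gradient f x‖ = ‖fderiv ℝ f x‖ := by
  simp [gradient]

theorem inner_gradient_eq (f : Plane → ℝ) (x v : Plane) :
    inner ℝ (gradient f x) v = fderiv ℝ f x v := by
  simp [gradient]

theorem ContDiff.continuous_gradient {f : Plane → ℝ} (hf : ContDiff ℝ ∞ f) :
    Continuous (gradient f) :=
  (InnerProductSpace.toDual ℝ Plane).symm.continuous.comp (hf.continuous_fderiv (by simp))

theorem gradient_add_apply {f g : Plane → ℝ} {x : Plane} (hf : DifferentiableAt ℝ f x)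
    (hg : DifferentiableAt ℝ g x) :
    gradient (f + g) x = gradient f x + gradient g x := by
  simp [gradient, fderiv_add hf hg]

theorem gradient_const_smul_apply {f : Plane → ℝ} {x : Plane} (c : ℝ)
    (hf : DifferentiableAt ℝ f x) :
    gradient (c • f) x = c • gradient f x := by
  simp [gradient, fderiv_const_smul hf]

theorem IsTestFunction.zero (Ω : Set Plane) : IsTestFunction Ω 0 :=
  ⟨contDiff_const, HasCompactSupport.zero, by simp [tsupport]⟩

theorem IsTestFunction.add {Ω : Set Plane} {φ ψ : Plane → ℝ} (hφ : IsTestFunction Ω φ)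
    (hψ : IsTestFunction Ω ψ) : IsTestFunction Ω (φ + ψ) :=
  ⟨hφ.1.add hψ.1, hφ.2.1.add hψ.2.1, (tsupport_add φ ψ).trans (union_subset hφ.2.2 hψ.2.2)⟩

theorem IsTestFunction.const_smul {Ω : Set Plane} {φ : Plane → ℝ} (c : ℝ)
    (hφ : IsTestFunction Ω φ) : IsTestFunction Ω (c • φ) :=
  ⟨contDiff_const.smul hφ.1, hφ.2.1.smul_left (f := fun _ => c),
    (tsupport_smul_subset_right (fun _ => c) φ).trans hφ.2.2⟩

theorem IsTestFunction.differentiable {Ω : Set Plane} {φ : Plane → ℝ} (hφ : IsTestFunction Ω φ) :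
    Differentiable ℝ φ :=
  hφ.1.differentiable (by simp)

theorem HasCompactSupport.gradient {φ : Plane → ℝ} (hφ : HasCompactSupport φ) :
    HasCompactSupport (gradient φ) :=
  (hφ.fderiv (𝕜 := ℝ)).comp_left (g := (InnerProductSpace.toDual ℝ Plane).symm) (map_zero _)

theorem IsTestFunction.memLp {Ω : Set Plane} {φ : Plane → ℝ} (hφ : IsTestFunction Ω φ) :
    MemLp φ 2 (volume.restrict Ω) :=
  (hφ.1.continuous.memLp_of_hasCompactSupport hφ.2.1).restrict Ω

theorem IsTestFunction.memLp_gradient {Ω : Set Plane} {φ : Plane → ℝ} (hφ : IsTestFunction Ω φ) :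
    MemLp (gradient φ) 2 (volume.restrict Ω) :=
  (hφ.1.continuous_gradient.memLp_of_hasCompactSupport hφ.2.1.gradient).restrict Ω

/-! ### The form domain as a closed subspace -/

/-- The pairs `(φ, ∇φ)` with `φ` a test function. -/
def testGraph (Ω : Set Plane) : Submodule ℝ (L2 Ω × L2Field Ω) where
  carrier := {p | ∃ φ, IsTestFunction Ω φ ∧ p.1 =ᵐ[volume.restrict Ω] φ ∧
    p.2 =ᵐ[volume.restrict Ω] gradient φ}
  zero_mem' := by
    refine ⟨0, .zero Ω, Lp.coeFn_zero _ _ _, (Lp.coeFn_zero _ _ _).trans (.of_forall fun x => ?_)⟩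
    simp [gradient]
  add_mem' := by
    rintro p q ⟨φ, hφ, h1, h2⟩ ⟨ψ, hψ, h3, h4⟩
    refine ⟨φ + ψ, hφ.add hψ, (Lp.coeFn_add _ _).trans (h1.add h3),
      (Lp.coeFn_add _ _).trans ((h2.add h4).trans (.of_forall fun x => ?_))⟩
    exact (gradient_add_apply (hφ.differentiable x) (hψ.differentiable x)).symm
  smul_mem' := by
    rintro c p ⟨φ, hφ, h1, h2⟩
    refine ⟨c • φ, hφ.const_smul c, (Lp.coeFn_smul _ _).trans (h1.const_smul c),
      (Lp.coeFn_smul _ _).trans ((h2.const_smul c).trans (.of_forall fun x => ?_))⟩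
    exact (gradient_const_smul_apply c (hφ.differentiable x)).symm

/-- Closures in a metric space are sequential, so H¹₀ with its gradient becomes a closed subspace of
a Hilbert space. -/
theorem hasDirichletGradient_iff {Ω : Set Plane} {u : L2 Ω} {G : L2Field Ω} :
    HasDirichletGradient Ω u G ↔ (u, G) ∈ (testGraph Ω).topologicalClosure := by
  rw [← SetLike.mem_coe, Submodule.topologicalClosure_coe, mem_closure_iff_seq_limit]
  constructor
  · rintro ⟨φ, hφ, h1, h2⟩
    refine ⟨fun n => ((hφ n).memLp.toLp (φ n), (hφ n).memLp_gradient.toLp (gradient (φ n))), fun n =>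
      ⟨φ n, hφ n, (hφ n).memLp.coeFn_toLp, (hφ n).memLp_gradient.coeFn_toLp⟩, ?_⟩
    refine Tendsto.prodMk_nhds ?_ ?_
    · rw [Lp.tendsto_Lp_iff_tendsto_eLpNorm']
      refine h1.congr fun n => eLpNorm_congr_ae ?_
      filter_upwards [(hφ n).memLp.coeFn_toLp] with x hx
      simp [hx]
    · rw [Lp.tendsto_Lp_iff_tendsto_eLpNorm']
      refine h2.congr fun n => eLpNorm_congr_ae ?_
      filter_upwards [(hφ n).memLp_gradient.coeFn_toLp] with x hx
      simp [hx]
  · rintro ⟨p, hp, hlim⟩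
    choose φ hφ h1 h2 using hp
    have hl1 := (continuous_fst.tendsto _).comp hlim
    have hl2 := (continuous_snd.tendsto _).comp hlim
    rw [Lp.tendsto_Lp_iff_tendsto_eLpNorm'] at hl1 hl2
    refine ⟨φ, hφ, hl1.congr fun n => eLpNorm_congr_ae ?_, hl2.congr fun n => eLpNorm_congr_ae ?_⟩
    · filter_upwards [h1 n] with x hx
      simp [hx]
    · filter_upwards [h2 n] with x hx
      simp [hx]

/-- The weak equation is linear and continuous in the pair (ψ, ∇ψ), hence passes to the closure.
Elements of H¹₀ may then serve as test functions, in particular other solutions. -/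
theorem isNegDirichletLaplacian_iff {Ω : Set Plane} {u f : L2 Ω} :
    IsNegDirichletLaplacian Ω u f ↔ ∃ G : L2Field Ω, (u, G) ∈ (testGraph Ω).topologicalClosure ∧
      ∀ p ∈ (testGraph Ω).topologicalClosure, inner ℝ G p.2 = inner ℝ f p.1 := by
  simp only [IsNegDirichletLaplacian, hasDirichletGradient_iff]
  refine exists_congr fun G => and_congr_right fun _ => ⟨fun h p hp => ?_, fun h ψ hψ => ?_⟩
  · have hcl : IsClosed {p : L2 Ω × L2Field Ω | inner ℝ G p.2 = inner ℝ f p.1} :=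
      isClosed_eq (by fun_prop) (by fun_prop)
    refine closure_minimal ?_ hcl hp
    rintro q ⟨ψ, hψ, h1, h2⟩
    have := h ψ hψ
    simp only [mem_ofPred_eq, L2.inner_def]
    calc _ = ∫ x in Ω, inner ℝ (G x) (gradient ψ x) := by
            refine integral_congr_ae ?_
            filter_upwards [h2] with x hx
            rw [hx]
      _ = _ := by
            rw [this]
            refine integral_congr_ae ?_
            filter_upwards [h1] with x hx
            simp [hx, mul_comm]
  · have := h (hψ.memLp.toLp ψ, hψ.memLp_gradient.toLp (gradient ψ)) (subset_closure
      ⟨ψ, hψ, hψ.memLp.coeFn_toLp, hψ.memLp_gradient.coeFn_toLp⟩)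
    simp only [L2.inner_def] at this
    calc _ = _ := by
            refine integral_congr_ae ?_
            filter_upwards [hψ.memLp_gradient.coeFn_toLp] with x hx
            rw [hx]
      _ = _ := this
      _ = _ := by
            refine integral_congr_ae ?_
            filter_upwards [hψ.memLp.coeFn_toLp] with x hx
            simp [hx, mul_comm]

/-! ### The Dirichlet Laplacian is linear, symmetric and closed -/

/-- The graph of `-Δ_Ω` as a subspace. -/
def laplacianGraph (Ω : Set Plane) : Submodule ℝ (L2 Ω × L2 Ω) where
  carrier := {p | IsNegDirichletLaplacian Ω p.1 p.2}
  zero_mem' := isNegDirichletLaplacian_iff.2 ⟨0, Submodule.zero_mem _, by simp⟩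
  add_mem' := by
    rintro p q hp hq
    obtain ⟨G, hG, h⟩ := isNegDirichletLaplacian_iff.1 hp
    obtain ⟨H, hH, h'⟩ := isNegDirichletLaplacian_iff.1 hq
    refine isNegDirichletLaplacian_iff.2 ⟨G + H, Submodule.add_mem _ hG hH, fun r hr => ?_⟩
    simp only [Prod.snd_add, inner_add_left, h r hr, h' r hr]
  smul_mem' := by
    rintro c p hp
    obtain ⟨G, hG, h⟩ := isNegDirichletLaplacian_iff.1 hp
    refine isNegDirichletLaplacian_iff.2 ⟨c • G, Submodule.smul_mem _ c hG, fun r hr => ?_⟩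
    simp only [Prod.smul_snd, real_inner_smul_left, h r hr]

theorem mem_laplacianGraph {Ω : Set Plane} {u f : L2 Ω} :
    (u, f) ∈ laplacianGraph Ω ↔ IsNegDirichletLaplacian Ω u f := Iff.rfl

/-- Testing each equation with the other solution shows that both sides equal the Dirichlet form
⟨∇u, ∇v⟩. -/
theorem IsNegDirichletLaplacian.inner_comm {Ω : Set Plane} {u f v g : L2 Ω}
    (hu : IsNegDirichletLaplacian Ω u f) (hv : IsNegDirichletLaplacian Ω v g) :
    inner ℝ f v = inner ℝ u g := by
  obtain ⟨G, hG, h⟩ := isNegDirichletLaplacian_iff.1 hu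
  obtain ⟨H, hH, h'⟩ := isNegDirichletLaplacian_iff.1 hv
  have h1 := h _ hH
  have h2 := h' _ hG
  simp only at h1 h2
  rw [← h1, real_inner_comm, h2, real_inner_comm]

/-- The only point is that the gradients converge as well. This closedness is what allows the
Laplacian to be applied to an eigenfunction series term by term. -/
theorem isClosed_laplacianGraph (Ω : Set Plane) :
    IsClosed (laplacianGraph Ω : Set (L2 Ω × L2 Ω)) := by
  refine isClosed_of_closure_subset fun p hp => ?_
  obtain ⟨q, hq, hlim⟩ := mem_closure_iff_seq_limit.1 hp
  choose G hG hGq using fun n => isNegDirichletLaplacian_iff.1 (hq n)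
  -- Testing the equation of a difference with that difference gives ‖G_m - G_n‖² = ⟨f_m - f_n, u_m
  -- - u_n⟩, so the gradients are Cauchy.
  have hbound : ∀ m n, ‖G m - G n‖ ^ 2 ≤ ‖q m - q n‖ ^ 2 := by
    intro m n
    have hmem := Submodule.sub_mem _ (hG m) (hG n)
    have h1 := hGq m _ hmem
    have h2 := hGq n _ hmem
    simp only [Prod.mk_sub_mk] at h1 h2
    rw [← real_inner_self_eq_norm_sq, inner_sub_left, h1, h2, ← inner_sub_left, sq]
    refine (real_inner_le_norm _ _).trans (mul_le_mul ?_ ?_ (norm_nonneg _) (norm_nonneg _))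
    · exact norm_snd_le (q m - q n)
    · exact norm_fst_le (q m - q n)
  have hcau : CauchySeq G := by
    rw [Metric.cauchySeq_iff]
    intro ε hε
    obtain ⟨N, hN⟩ := Metric.cauchySeq_iff.1 hlim.cauchySeq ε hε
    refine ⟨N, fun m hm n hn => lt_of_le_of_lt ?_ (hN m hm n hn)⟩
    rw [dist_eq_norm, dist_eq_norm]
    exact le_of_sq_le_sq (hbound m n) (norm_nonneg _)
  obtain ⟨H, hH⟩ := cauchySeq_tendsto_of_complete hcau
  have hl1 := (continuous_fst.tendsto _).comp hlim
  have hl2 := (continuous_snd.tendsto _).comp hlim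
  refine isNegDirichletLaplacian_iff.2 ⟨H, ?_, fun r hr => ?_⟩
  · exact (testGraph Ω).isClosed_topologicalClosure.mem_of_tendsto (hl1.prodMk_nhds hH)
      (.of_forall hG)
  · exact tendsto_nhds_unique (hH.inner tendsto_const_nhds)
      ((hl2.inner tendsto_const_nhds).congr fun n => (hGq n r hr).symm)

/-! ### The heat problem in terms of an eigenbasis -/

/-- A Hilbert basis of Dirichlet eigenfunctions whose heat trace is finite. -/
structure IsDirichletEigenbasis {Ω : Set Plane} {ι : Type*} (b : HilbertBasis ι ℝ (L2 Ω))
    (ev : ι → ℝ) : Prop where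
  nonneg : ∀ i, 0 ≤ ev i
  eigen : ∀ i, IsNegDirichletLaplacian Ω (b i) (ev i • b i)
  summable : ∀ s : ℝ, 0 < s → Summable fun i => exp (-(s * ev i))

/-- The constant function `1` as an element of `L²(Ω)`. -/
def unitL2 (Ω : Set Plane) [IsFiniteMeasure ((volume : Measure Plane).restrict Ω)] : L2 Ω :=
  Lp.const 2 (volume.restrict Ω) (1 : ℝ)

/-- The spectral representation of the solution of the heat problem. -/
def spectralHeat {Ω : Set Plane} [IsFiniteMeasure ((volume : Measure Plane).restrict Ω)]
    {ι : Type*} (b : HilbertBasis ι ℝ (L2 Ω)) (ev : ι → ℝ) (t : ℝ) : L2 Ω :=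
  ∑' i, (exp (-(ev i * t)) * inner ℝ (b i) (unitL2 Ω)) • b i

/-! ### Coefficients with respect to a Hilbert basis -/

theorem Submodule.mem_of_hasSum {ι E : Type*} [AddCommGroup E] [Module ℝ E] [TopologicalSpace E]
    (S : Submodule ℝ E) (hS : IsClosed (S : Set E)) {f : ι → E} {x : E} (hx : HasSum f x)
    (hf : ∀ i, f i ∈ S) : x ∈ S :=
  hS.mem_of_tendsto hx (.of_forall fun _ => S.sum_mem fun i _ => hf i)

theorem HilbertBasis.eq_of_inner_eq {ι E : Type*} [NormedAddCommGroup E] [InnerProductSpace ℝ E]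
    (b : HilbertBasis ι ℝ E) {x y : E} (h : ∀ i, inner ℝ (b i) x = inner ℝ (b i) y) : x = y := by
  refine b.repr.injective (lp.ext (funext fun i => ?_))
  rw [b.repr_apply_apply, b.repr_apply_apply, h i]

theorem HilbertBasis.inner_tsum_smul {ι E : Type*} [NormedAddCommGroup E] [InnerProductSpace ℝ E]
    (b : HilbertBasis ι ℝ E) {c : ι → ℝ} (hc : Summable fun i => c i • b i) (i : ι) :
    inner ℝ (b i) (∑' j, c j • b j) = c i := by
  classical
  have h := hc.hasSum.mapL (innerSL ℝ (b i))
  rw [← innerSL_apply_apply ℝ (b i), ← h.tsum_eq, tsum_eq_single i]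
  · simp [b.orthonormal.1 i]
  · intro j hj
    simp [b.orthonormal.2 hj.symm]

theorem HilbertBasis.hasSum_inner_sq {ι E : Type*} [NormedAddCommGroup E] [InnerProductSpace ℝ E]
    (b : HilbertBasis ι ℝ E) (x : E) : HasSum (fun i => inner ℝ (b i) x ^ 2) (‖x‖ ^ 2) := by
  rw [← real_inner_self_eq_norm_sq]
  refine (b.hasSum_inner_mul_inner x x).congr_fun ?_
  intro i
  rw [sq, real_inner_comm x]

theorem HilbertBasis.abs_inner_le {ι E : Type*} [NormedAddCommGroup E] [InnerProductSpace ℝ E]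
    (b : HilbertBasis ι ℝ E) (x : E) (i : ι) : |inner ℝ (b i) x| ≤ ‖x‖ := by
  simpa [b.orthonormal.1 i] using abs_real_inner_le_norm (b i) x

/-! ### Existence, uniqueness and large-time behaviour of the heat solution -/

section

variable {Ω : Set Plane} [IsFiniteMeasure ((volume : Measure Plane).restrict Ω)] {ι : Type*}
  {b : HilbertBasis ι ℝ (L2 Ω)} {ev : ι → ℝ}

theorem unitL2_coeFn (Ω : Set Plane) [IsFiniteMeasure ((volume : Measure Plane).restrict Ω)] :
    unitL2 Ω =ᵐ[volume.restrict Ω] fun _ => 1 :=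
  Lp.coeFn_const _ _ _

theorem inner_unitL2 (f : L2 Ω) : inner ℝ f (unitL2 Ω) = ∫ x in Ω, f x := by
  rw [L2.inner_def]
  refine integral_congr_ae ?_
  filter_upwards [unitL2_coeFn Ω] with x hx
  simp [hx]

theorem IsDirichletEigenbasis.summable_spectralHeat (h : IsDirichletEigenbasis b ev) {t : ℝ}
    (ht : 0 < t) :
    Summable fun i => (exp (-(ev i * t)) * inner ℝ (b i) (unitL2 Ω)) • b i := by
  refine Summable.of_norm_bounded ((h.summable t ht).mul_right ‖unitL2 Ω‖) fun i => ?_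
  rw [norm_smul, b.orthonormal.1 i, mul_one, norm_mul, norm_of_nonneg (exp_pos _).le, mul_comm t]
  exact mul_le_mul_of_nonneg_left (b.abs_inner_le _ _) (exp_pos _).le

theorem IsDirichletEigenbasis.inner_spectralHeat (h : IsDirichletEigenbasis b ev) {t : ℝ}
    (ht : 0 < t) (i : ι) :
    inner ℝ (b i) (spectralHeat b ev t) = exp (-(ev i * t)) * inner ℝ (b i) (unitL2 Ω) :=
  b.inner_tsum_smul (h.summable_spectralHeat ht) i

/-- Half of the exponent absorbs the factor `r`, by x ≤ exp x; the other half remains for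
summability. -/
theorem mul_exp_neg_le {r s : ℝ} (hs : 0 < s) :
    r * exp (-(r * (2 * s))) ≤ s⁻¹ * exp (-(s * r)) := by
  have h1 : s * r ≤ exp (s * r) := by linarith [add_one_le_exp (s * r)]
  have h2 : exp (-(r * (2 * s))) = exp (-(s * r)) * exp (-(s * r)) := by
    rw [← exp_add]; ring_nf
  have h3 : exp (s * r) * exp (-(s * r)) = 1 := by rw [← exp_add]; simp
  have h4 : s * r * exp (-(s * r)) ≤ 1 := by
    rw [← h3]; exact mul_le_mul_of_nonneg_right h1 (exp_pos _).le
  rw [h2, inv_mul_eq_div, le_div_iff₀ hs]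
  nlinarith [exp_pos (-(s * r))]

/-- The differentiated series is dominated by the heat trace at a smaller positive time, so it may
be differentiated termwise; the closed graph identifies the sum as the image under the Laplacian. -/
theorem IsDirichletEigenbasis.hasDerivAt_spectralHeat (h : IsDirichletEigenbasis b ev) {t : ℝ}
    (ht : 0 < t) :
    IsNegDirichletLaplacian Ω (spectralHeat b ev t)
      (∑' i, (ev i * (exp (-(ev i * t)) * inner ℝ (b i) (unitL2 Ω))) • b i) ∧
    HasDerivAt (spectralHeat b ev)
      (-∑' i, (ev i * (exp (-(ev i * t)) * inner ℝ (b i) (unitL2 Ω))) • b i) t := by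
  -- Uniformity needs a neighbourhood of `t` away from 0. For times above `t / 2` the exponent is
  -- split into two quarters of `t`, one of which absorbs the eigenvalue.
  have hbd : ∀ i, ∀ s ∈ Ioi (t / 2),
      ‖(ev i * (exp (-(ev i * s)) * inner ℝ (b i) (unitL2 Ω))) • b i‖
        ≤ (t / 4)⁻¹ * exp (-(t / 4 * ev i)) * ‖unitL2 Ω‖ := by
    intro i s hs
    rw [norm_smul, b.orthonormal.1 i, mul_one, ← mul_assoc, norm_mul,
      norm_of_nonneg (mul_nonneg (h.nonneg i) (exp_pos _).le)]
    refine mul_le_mul ?_ (b.abs_inner_le _ _) (norm_nonneg _) (by positivity)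
    refine le_trans ?_ (mul_exp_neg_le (by positivity))
    refine mul_le_mul_of_nonneg_left (exp_le_exp.2 ?_) (h.nonneg i)
    have := mul_le_mul_of_nonneg_left (le_of_lt (mem_Ioi.1 hs)) (h.nonneg i)
    linarith
  have hsum : Summable fun i => (t / 4)⁻¹ * exp (-(t / 4 * ev i)) * ‖unitL2 Ω‖ :=
    ((h.summable (t / 4) (by positivity)).mul_left _).mul_right _
  have hmem : t ∈ Ioi (t / 2) := by simp only [mem_Ioi]; linarith
  have hsum' : Summable fun i => (ev i * (exp (-(ev i * t)) * inner ℝ (b i) (unitL2 Ω))) • b i :=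
    Summable.of_norm_bounded hsum fun i => hbd i t hmem
  constructor
  · have hs := ((h.summable_spectralHeat ht).hasSum).prodMk hsum'.hasSum
    refine mem_laplacianGraph.1
      ((laplacianGraph Ω).mem_of_hasSum (isClosed_laplacianGraph Ω) hs fun i => ?_)
    have := (laplacianGraph Ω).smul_mem (exp (-(ev i * t)) * inner ℝ (b i) (unitL2 Ω))
      (mem_laplacianGraph.2 (h.eigen i))
    rwa [Prod.smul_mk, smul_smul, mul_comm _ (ev i)] at this
  · rw [← tsum_neg]
    refine hasDerivAt_tsum_of_isPreconnected
      (g := fun i s => (exp (-(ev i * s)) * inner ℝ (b i) (unitL2 Ω)) • b i)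
      (g' := fun i s => -((ev i * (exp (-(ev i * s)) * inner ℝ (b i) (unitL2 Ω))) • b i))
      hsum isOpen_Ioi isPreconnected_Ioi
      (fun i s _ => ?_) (fun i s hs => ?_) hmem (h.summable_spectralHeat ht) hmem
    · have h1 : HasDerivAt (fun s => exp (-(ev i * s))) (exp (-(ev i * s)) * (-(ev i * 1))) s :=
        (((hasDerivAt_id s).const_mul (ev i)).neg).exp
      have h2 := (h1.mul_const (inner ℝ (b i) (unitL2 Ω))).smul_const (b i)
      refine h2.congr_deriv ?_
      rw [← neg_smul]
      congr 1
      ring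
    · rw [norm_neg]
      exact hbd i s hs

/-- By Parseval the squared distance is a sum of (exp(-λt) - 1)² ⟨b_i, 1⟩². As λ ≥ 0, it is
dominated by the summable ⟨b_i, 1⟩², and each term tends to 0. -/
theorem IsDirichletEigenbasis.tendsto_spectralHeat (h : IsDirichletEigenbasis b ev) :
    Tendsto (spectralHeat b ev) (𝓝[>] 0) (𝓝 (unitL2 Ω)) := by
  rw [tendsto_iff_norm_sub_tendsto_zero]
  have hsq : Tendsto (fun t => ‖spectralHeat b ev t - unitL2 Ω‖ ^ 2) (𝓝[>] 0) (𝓝 0) := by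
    have key := tendsto_tsum_of_dominated_convergence (𝓕 := 𝓝[>] (0 : ℝ))
      (f := fun t i => ((exp (-(ev i * t)) - 1) * inner ℝ (b i) (unitL2 Ω)) ^ 2)
      (g := fun _ => 0) (b.hasSum_inner_sq (unitL2 Ω)).summable (fun i => ?_) ?_
    · rw [tsum_zero] at key
      refine key.congr' ?_
      filter_upwards [self_mem_nhdsWithin] with t ht
      rw [← (b.hasSum_inner_sq _).tsum_eq]
      refine tsum_congr fun i => ?_
      rw [inner_sub_right, h.inner_spectralHeat ht]
      ring
    · have : Continuous fun t => ((exp (-(ev i * t)) - 1) * inner ℝ (b i) (unitL2 Ω)) ^ 2 := by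
        fun_prop
      have h0 := (this.tendsto 0).mono_left (nhdsWithin_le_nhds (s := Ioi 0))
      simpa using h0
    · filter_upwards [self_mem_nhdsWithin] with t ht i
      rw [norm_of_nonneg (sq_nonneg _), mul_pow]
      have h1 : exp (-(ev i * t)) ≤ 1 :=
        exp_le_one_iff.2 (neg_nonpos.2 (mul_nonneg (h.nonneg i) (le_of_lt ht)))
      have h2 := exp_pos (-(ev i * t))
      exact mul_le_of_le_one_left (sq_nonneg _) (by nlinarith)
  have := hsq.sqrt
  simpa [Real.sqrt_sq (norm_nonneg _)] using this

theorem tendsto_unitL2_iff {u : ℝ → L2 Ω} {l : Filter ℝ} :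
    Tendsto u l (𝓝 (unitL2 Ω)) ↔
      Tendsto (fun t => eLpNorm (fun x => u t x - 1) 2 (volume.restrict Ω)) l (𝓝 0) := by
  rw [Lp.tendsto_Lp_iff_tendsto_eLpNorm']
  refine tendsto_congr fun t => eLpNorm_congr_ae ?_
  filter_upwards [unitL2_coeFn Ω] with x hx
  simp [hx]

theorem IsDirichletEigenbasis.isHeatSolution (h : IsDirichletEigenbasis b ev) :
    IsHeatSolution Ω (spectralHeat b ev) :=
  ⟨fun _ ht => ⟨_, h.hasDerivAt_spectralHeat ht⟩, tendsto_unitL2_iff.1 h.tendsto_spectralHeat⟩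

/-- By symmetry of the Laplacian each coefficient satisfies c' = -λc, so exp(λs) c(s) is constant
for s > 0; the initial condition fixes the constant. -/
theorem IsDirichletEigenbasis.eq_spectralHeat (h : IsDirichletEigenbasis b ev) {u : ℝ → L2 Ω}
    (hu : IsHeatSolution Ω u) {t : ℝ} (ht : 0 < t) : u t = spectralHeat b ev t := by
  refine b.eq_of_inner_eq fun i => ?_
  rw [h.inner_spectralHeat ht]
  have hd : ∀ s ∈ Ioi (0 : ℝ), HasDerivAt (fun s => exp (ev i * s) * inner ℝ (b i) (u s)) 0 s := by
    intro s hs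
    obtain ⟨f, hf, hder⟩ := hu.1 s hs
    have h1 : HasDerivAt (fun s => exp (ev i * s)) (exp (ev i * s) * (ev i * 1)) s :=
      ((hasDerivAt_id s).const_mul (ev i)).exp
    have h2 : HasDerivAt (fun s => inner ℝ (b i) (u s)) (inner ℝ (b i) (-f)) s :=
      ((innerSL ℝ (b i)).hasFDerivAt.comp_hasDerivAt s hder)
    have h3 : inner ℝ (b i) f = ev i * inner ℝ (b i) (u s) := by
      rw [← (h.eigen i).inner_comm hf, real_inner_smul_left]
    refine (h1.mul h2).congr_deriv ?_
    rw [inner_neg_right, h3]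
    ring
  have hconst : ∀ s ∈ Ioi (0 : ℝ),
      exp (ev i * s) * inner ℝ (b i) (u s) = exp (ev i * t) * inner ℝ (b i) (u t) := fun s hs =>
    isOpen_Ioi.is_const_of_deriv_eq_zero isPreconnected_Ioi
      (fun r hr => (hd r hr).differentiableAt.differentiableWithinAt)
      (fun r hr => (hd r hr).deriv) hs ht
  have hlim : Tendsto (fun s => exp (ev i * s) * inner ℝ (b i) (u s)) (𝓝[>] 0)
      (𝓝 (1 * inner ℝ (b i) (unitL2 Ω))) := by
    refine Tendsto.mul ?_ (tendsto_const_nhds.inner (tendsto_unitL2_iff.2 hu.2))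
    have : Continuous fun s => exp (ev i * s) := by fun_prop
    simpa using (this.tendsto 0).mono_left (nhdsWithin_le_nhds (s := Ioi 0))
  have heq : exp (ev i * t) * inner ℝ (b i) (u t) = 1 * inner ℝ (b i) (unitL2 Ω) :=
    tendsto_nhds_unique (tendsto_const_nhds.congr'
      (by filter_upwards [self_mem_nhdsWithin] with s hs using (hconst s hs).symm)) hlim
  rw [one_mul] at heq
  rw [← heq, ← mul_assoc, ← exp_add, neg_add_cancel, exp_zero, one_mul]

theorem IsDirichletEigenbasis.heatProblemWellPosed (h : IsDirichletEigenbasis b ev) :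
    HeatProblemWellPosed Ω :=
  ⟨⟨_, h.isHeatSolution⟩, fun _ _ hu hv _ ht =>
    (h.eq_spectralHeat hu ht).trans (h.eq_spectralHeat hv ht).symm⟩

/-- Parseval for ⟨u(t), 1⟩. By uniqueness the solution picked in the definition of `heatContent` is
the spectral one. -/
theorem IsDirichletEigenbasis.hasSum_heatContent (h : IsDirichletEigenbasis b ev) {t : ℝ}
    (ht : 0 < t) :
    HasSum (fun i => exp (-(ev i * t)) * inner ℝ (b i) (unitL2 Ω) ^ 2) (heatContent Ω t) := by
  have hex : ∃ u, IsHeatSolution Ω u := ⟨_, h.isHeatSolution⟩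
  rw [heatContent, dif_pos hex, h.eq_spectralHeat hex.choose_spec ht, ← inner_unitL2]
  refine (b.hasSum_inner_mul_inner _ _).congr_fun fun i => ?_
  rw [real_inner_comm (b i), h.inner_spectralHeat ht]
  ring

/-- If one eigenvalue is singled out and all others are at least `μ`, then its contribution
approximates the heat content up to `O(e^{-μ t})`. -/
theorem IsDirichletEigenbasis.heatContent_isBigO (h : IsDirichletEigenbasis b ev) (i₀ : ι) {μ : ℝ}
    (hμ : ∀ i, i ≠ i₀ → μ ≤ ev i) :
    (fun t => heatContent Ω t - inner ℝ (b i₀) (unitL2 Ω) ^ 2 * exp (-(ev i₀ * t)))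
      =O[atTop] fun t => exp (-(μ * t)) := by
  classical
  refine IsBigO.of_bound (‖unitL2 Ω‖ ^ 2) ?_
  filter_upwards [eventually_gt_atTop 0] with t ht
  have hs := h.hasSum_heatContent ht
  have hdiff := hs.sub (hasSum_pi_single i₀ (exp (-(ev i₀ * t)) * inner ℝ (b i₀) (unitL2 Ω) ^ 2))
  -- With the distinguished term removed, each term lies between 0 and exp(-μt) ⟨b_i, 1⟩², and these
  -- bounds sum to exp(-μt) ‖1‖².
  have hterm : ∀ i, 0 ≤ exp (-(ev i * t)) * inner ℝ (b i) (unitL2 Ω) ^ 2 -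
        (Pi.single i₀ (exp (-(ev i₀ * t)) * inner ℝ (b i₀) (unitL2 Ω) ^ 2) : ι → ℝ) i ∧
      exp (-(ev i * t)) * inner ℝ (b i) (unitL2 Ω) ^ 2 -
        (Pi.single i₀ (exp (-(ev i₀ * t)) * inner ℝ (b i₀) (unitL2 Ω) ^ 2) : ι → ℝ) i
      ≤ exp (-(μ * t)) * inner ℝ (b i) (unitL2 Ω) ^ 2 := by
    intro i
    by_cases hi : i = i₀
    · subst hi
      simp only [Pi.single_eq_same, sub_self, le_refl, true_and]
      positivity
    · simp only [Pi.single_eq_of_ne hi, sub_zero]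
      refine ⟨by positivity, mul_le_mul_of_nonneg_right (exp_le_exp.2 ?_) (sq_nonneg _)⟩
      exact neg_le_neg (mul_le_mul_of_nonneg_right (hμ i hi) ht.le)
  have h0 := hdiff.nonneg fun i => (hterm i).1
  have h1 := hasSum_le (fun i => (hterm i).2) hdiff
    ((b.hasSum_inner_sq (unitL2 Ω)).mul_left (exp (-(μ * t))))
  rw [mul_comm (inner ℝ _ _ ^ 2), norm_of_nonneg h0, norm_of_nonneg (exp_pos _).le,
    mul_comm (‖_‖ ^ 2)]
  exact h1

end

/-! ### Enumeration of eigenvalues -/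

/-- Each index is ranked by the number of its predecessors, which is finite; the ranks form an
infinite subset of ℕ, and that subset is order isomorphic to ℕ. -/
theorem exists_monotone_enumeration {ι : Type*} [Countable ι] [Infinite ι] (k : ι → ℝ)
    (hfin : ∀ r, {i | k i ≤ r}.Finite) :
    ∃ e : ℕ ≃ ι, Monotone (k ∘ e) ∧ Tendsto (k ∘ e) atTop atTop := by
  classical
  obtain ⟨enc, henc⟩ := exists_injective_nat ι
  -- Multiple eigenvalues make `k` non-injective; the second component breaks ties.
  set key : ι → ℝ ×ₗ ℕ := fun i => toLex (k i, enc i) with hkey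
  have hkinj : Function.Injective key := fun i j hij => henc (by simpa [hkey] using (congrArg
    (fun p => (ofLex p).2) hij))
  have hbelow : ∀ i, {j | key j < key i}.Finite := fun i =>
    (hfin (k i)).subset fun j hj => by
      rcases (Prod.Lex.toLex_lt_toLex.1 hj) with h | h
      · exact h.le
      · exact h.1.le
  set g : ι → ℕ := fun i => {j | key j < key i}.ncard with hg
  have hmono : ∀ {i j}, key i < key j → g i < g j := fun {i j} hij =>
    ncard_lt_ncard ⟨fun l hl => lt_trans hl hij, fun h => lt_irrefl (key i) (h hij)⟩ (hbelow j)
  have hginj : Function.Injective g := by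
    intro i j hij
    rcases lt_trichotomy (key i) (key j) with h | h | h
    · exact absurd hij (hmono h).ne
    · exact hkinj h
    · exact absurd hij (hmono h).ne'
  have : Infinite (range g) := (infinite_range_of_injective hginj).to_subtype
  let e : ℕ ≃ ι := (Nat.Subtype.orderIsoOfNat (range g)).toEquiv.trans
    (Equiv.ofInjective g hginj).symm
  have hge : ∀ n, g (e n) = (Nat.Subtype.orderIsoOfNat (range g) n : ℕ) := fun n => by
    have := (Equiv.ofInjective g hginj).apply_symm_apply (Nat.Subtype.orderIsoOfNat (range g) n)
    exact congrArg Subtype.val this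
  refine ⟨e, fun m n hmn => ?_, ?_⟩
  · by_contra! hlt
    have h1 : g (e n) < g (e m) := hmono (Prod.Lex.toLex_lt_toLex.2 (Or.inl hlt))
    rw [hge, hge] at h1
    exact absurd ((Nat.Subtype.orderIsoOfNat (range g)).monotone hmn) (not_le.2 h1)
  · rw [← Nat.cofinite_eq_atTop]
    refine Tendsto.comp (y := cofinite) ?_ e.injective.tendsto_cofinite
    refine tendsto_atTop.2 fun r => ?_
    rw [eventually_cofinite]
    exact (hfin r).subset fun i hi => (not_le.1 hi).le

/-- Summable terms tend to 0 along the cofinite filter, so only finitely many reach exp(-sr). -/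
theorem finite_le_of_summable_exp {ι : Type*} {ev : ι → ℝ} {s : ℝ} (hs : 0 < s)
    (h : Summable fun i => exp (-(s * ev i))) (r : ℝ) : {i | ev i ≤ r}.Finite := by
  have := h.tendsto_cofinite_zero.eventually (gt_mem_nhds (exp_pos (-(s * r))))
  rw [eventually_cofinite] at this
  refine this.subset fun i hi => not_lt.2 (exp_le_exp.2 (neg_le_neg ?_))
  exact mul_le_mul_of_nonneg_left hi hs.le

theorem IsDirichletEigenbasis.isDirichletSpectrum {Ω : Set Plane} {ι : Type*}
    {b : HilbertBasis ι ℝ (L2 Ω)} {ev : ι → ℝ} (h : IsDirichletEigenbasis b ev) (e : ℕ ≃ ι)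
    (hmono : Monotone (ev ∘ e)) (hlim : Tendsto (ev ∘ e) atTop atTop) :
    IsDirichletSpectrum Ω (ev ∘ e) := by
  have hspan : ⊤ ≤ (Submodule.span ℝ (range (b ∘ e))).topologicalClosure := by
    rw [e.surjective.range_comp, b.dense_span]
  refine ⟨hmono, hlim, HilbertBasis.mk (b.orthonormal.comp e e.injective) hspan, fun j => ?_⟩
  rw [HilbertBasis.coe_mk]
  exact h.eigen (e j)

theorem isospectral_of_equiv {Ω₁ Ω₂ : Set Plane} {ι₁ ι₂ : Type*} [Countable ι₁] [Infinite ι₁]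
    {b₁ : HilbertBasis ι₁ ℝ (L2 Ω₁)} {b₂ : HilbertBasis ι₂ ℝ (L2 Ω₂)} {ev₁ : ι₁ → ℝ} {ev₂ : ι₂ → ℝ}
    (h₁ : IsDirichletEigenbasis b₁ ev₁) (h₂ : IsDirichletEigenbasis b₂ ev₂) (σ : ι₁ ≃ ι₂)
    (hσ : ∀ i, ev₂ (σ i) = ev₁ i) : Isospectral Ω₁ Ω₂ := by
  obtain ⟨e, hmono, hlim⟩ := exists_monotone_enumeration ev₁
    (finite_le_of_summable_exp one_pos (h₁.summable 1 one_pos))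
  have heq : ev₂ ∘ (e.trans σ) = ev₁ ∘ e := funext fun n => hσ (e n)
  refine ⟨ev₁ ∘ e, h₁.isDirichletSpectrum e hmono hlim, ?_⟩
  rw [← heq] at hmono hlim ⊢
  exact h₂.isDirichletSpectrum (e.trans σ) hmono hlim

/-! ### The eigenvalues of rectangles and triangles -/

/-- The indices of the eigenfunctions of a rectangle. -/
abbrev RectIndex : Type := {p : ℕ × ℕ // 0 < p.1 ∧ 0 < p.2}

/-- The indices of the eigenfunctions of a right isosceles triangle. -/
abbrev TriIndex : Type := {p : ℕ × ℕ // 0 < p.2 ∧ p.2 < p.1}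

/-- The eigenvalues of the rectangle `(0, a) × (0, b)`. -/
def rectEigenvalue (a b : ℝ) (p : RectIndex) : ℝ :=
  (p.1.1 * π / a) ^ 2 + (p.1.2 * π / b) ^ 2

/-- The eigenvalues of the right isosceles triangle with legs `c`. -/
def triEigenvalue (c : ℝ) (p : TriIndex) : ℝ :=
  (p.1.1 * π / c) ^ 2 + (p.1.2 * π / c) ^ 2

theorem summable_exp_neg_mul_sq {c : ℝ} (hc : 0 < c) :
    Summable fun n : ℕ => exp (-(c * (n : ℝ) ^ 2)) := by
  have := summable_exp_nat_mul_of_ge (c := -c) (by linarith) (f := fun n => (n : ℝ) ^ 2)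
    fun n => by exact_mod_cast Nat.le_self_pow two_ne_zero n
  simpa using this

theorem summable_exp_neg_mul_sq_add_sq {c d : ℝ} (hc : 0 < c) (hd : 0 < d) :
    Summable fun p : ℕ × ℕ => exp (-(c * (p.1 : ℝ) ^ 2 + d * (p.2 : ℝ) ^ 2)) := by
  refine ((summable_exp_neg_mul_sq hc).mul_of_nonneg (summable_exp_neg_mul_sq hd)
    (fun _ => (exp_pos _).le) (fun _ => (exp_pos _).le)).congr fun p => ?_
  rw [← exp_add]
  ring_nf

theorem summable_rectEigenvalue {a b s : ℝ} (ha : 0 < a) (hb : 0 < b) (hs : 0 < s) :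
    Summable fun p => exp (-(s * rectEigenvalue a b p)) := by
  have hc : 0 < s * (π / a) ^ 2 := by positivity
  have hd : 0 < s * (π / b) ^ 2 := by positivity
  refine ((summable_exp_neg_mul_sq_add_sq hc hd).comp_injective Subtype.val_injective).congr
    fun p => ?_
  simp only [Function.comp, rectEigenvalue]
  ring_nf

theorem summable_triEigenvalue {c s : ℝ} (hc : 0 < c) (hs : 0 < s) :
    Summable fun p => exp (-(s * triEigenvalue c p)) := by
  have hd : 0 < s * (π / c) ^ 2 := by positivity
  refine ((summable_exp_neg_mul_sq_add_sq hd hd).comp_injective Subtype.val_injective).congr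
    fun p => ?_
  simp only [Function.comp, triEigenvalue]
  ring_nf

/-- The correspondence between the eigenfunctions of the two bands. -/
def bandIndexMap : RectIndex ⊕ TriIndex → RectIndex ⊕ TriIndex
  | .inl ⟨(m, n), h⟩ => .inl ⟨(m, 2 * n), by simp at h ⊢; omega⟩
  | .inr ⟨(p, q), h⟩ =>
    if h0 : (p + q) % 2 = 0 then
      .inr ⟨((p + q) / 2, (p - q) / 2), by simp at h ⊢; omega⟩
    else if h1 : p % 2 = 0 then
      .inl ⟨(p / 2, q), by simp at h ⊢; omega⟩
    else .inl ⟨(q / 2, p), by simp at h ⊢; omega⟩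

/-- The three kinds of source have disjoint images that exhaust the target: rectangle modes with
even second index come from the square, those with odd second index from triangle modes of mixed
parity, and triangle modes from those of equal parity. -/
theorem bandIndexMap_bijective : Function.Bijective bandIndexMap := by
  constructor
  · rintro (⟨⟨m, n⟩, h⟩ | ⟨⟨m, n⟩, h⟩) (⟨⟨m', n'⟩, h'⟩ | ⟨⟨m', n'⟩, h'⟩) heq <;>
    simp only [bandIndexMap] at heq h h' ⊢ <;> (try split_ifs at heq) <;>
    simp only [Sum.inl.injEq, Sum.inr.injEq, Subtype.mk.injEq, Prod.mk.injEq, reduceCtorEq]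
      at heq ⊢ <;> omega
  · rintro (⟨⟨m, n⟩, h⟩ | ⟨⟨m, n⟩, h⟩)
    · simp only at h
      by_cases hn : n % 2 = 0
      · refine ⟨.inl ⟨(m, n / 2), by simp; omega⟩, ?_⟩
        simp only [bandIndexMap, Sum.inl.injEq, Subtype.mk.injEq, Prod.mk.injEq, true_and]
        omega
      -- The preimage is the decreasing arrangement of `2 * m` and `n`; they differ because `n` is
      -- odd.
      · rcases lt_or_ge n (2 * m) with hlt | hge
        · refine ⟨.inr ⟨(2 * m, n), by simp; omega⟩, ?_⟩
          simp only [bandIndexMap]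
          rw [dif_neg (by omega), dif_pos (by omega)]
          simp
        · refine ⟨.inr ⟨(n, 2 * m), by simp; omega⟩, ?_⟩
          simp only [bandIndexMap]
          rw [dif_neg (by omega), dif_neg (by omega)]
          simp
    · simp only at h
      refine ⟨.inr ⟨(m + n, m - n), by simp; omega⟩, ?_⟩
      simp only [bandIndexMap]
      rw [dif_pos (by omega)]
      simp only [Sum.inr.injEq, Subtype.mk.injEq, Prod.mk.injEq]
      omega

/-- For equal parity this is (p+q)² + (p-q)² = 2(p² + q²); in mixed parity, (2k)²/4 = k². -/
theorem eigenvalue_bandIndexMap (i : RectIndex ⊕ TriIndex) :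
    Sum.elim (rectEigenvalue 1 2) (triEigenvalue (√2)) (bandIndexMap i) =
      Sum.elim (rectEigenvalue 1 1) (triEigenvalue 2) i := by
  have h2 : (√2 : ℝ) ^ 2 = 2 := Real.sq_sqrt (by norm_num)
  rcases i with ⟨⟨m, n⟩, h⟩ | ⟨⟨p, q⟩, h⟩
  · simp only [bandIndexMap, Sum.elim_inl, rectEigenvalue]
    push_cast
    ring
  · simp only at h
    simp only [bandIndexMap]
    split_ifs with h0 h1
    · obtain ⟨k, hk⟩ : ∃ k, p = q + 2 * k := ⟨(p - q) / 2, by omega⟩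
      have e1 : (p + q) / 2 = q + k := by omega
      have e2 : (p - q) / 2 = k := by omega
      simp only [Sum.elim_inr, triEigenvalue, e1, e2]
      rw [div_pow, div_pow, h2, hk]
      push_cast
      ring
    · obtain ⟨k, hk⟩ : ∃ k, p = 2 * k := ⟨p / 2, by omega⟩
      have e1 : p / 2 = k := by omega
      simp only [Sum.elim_inl, Sum.elim_inr, triEigenvalue, rectEigenvalue, e1]
      rw [hk]
      push_cast
      ring
    · obtain ⟨k, hk⟩ : ∃ k, q = 2 * k := ⟨q / 2, by omega⟩
      have e1 : q / 2 = k := by omega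
      simp only [Sum.elim_inl, Sum.elim_inr, triEigenvalue, rectEigenvalue, e1]
      rw [hk]
      push_cast
      ring

instance : Infinite RectIndex :=
  Infinite.of_injective (fun n : ℕ => (⟨(n + 1, 1), by simp⟩ : RectIndex)) fun m n h => by
    simpa using h

/-! ### Classical eigenfunctions on one piece and on a union of two pieces -/

/-- A complete orthonormal family of Dirichlet eigenfunctions of the bounded open set `P`, given by
smooth functions on the plane, with finite heat trace. -/
structure IsEigenfamily (P : Set Plane) {ι : Type*} (ev : ι → ℝ) (w : ι → Plane → ℝ) : Prop where
  isOpen : IsOpen P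
  isBounded : Bornology.IsBounded P
  nonneg : ∀ i, 0 ≤ ev i
  summable : ∀ s : ℝ, 0 < s → Summable fun i => exp (-(s * ev i))
  contDiff : ∀ i, ContDiff ℝ ∞ (w i)
  approx : ∀ i, ∃ φ : ℕ → Plane → ℝ, (∀ n, IsTestFunction P (φ n)) ∧
    Tendsto (fun n => eLpNorm (fun x => φ n x - w i x) 2 (volume.restrict P)) atTop (𝓝 0) ∧
    Tendsto (fun n => eLpNorm (fun x => gradient (φ n) x - gradient (w i) x) 2
      (volume.restrict P)) atTop (𝓝 0)
  weak : ∀ i ψ, IsTestFunction P ψ →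
    ∫ x in P, inner ℝ (gradient (w i) x) (gradient ψ x) = ev i * ∫ x in P, w i x * ψ x
  normalized : ∀ i, ∫ x in P, w i x * w i x = 1
  orthogonal : ∀ i j, i ≠ j → ∫ x in P, w i x * w j x = 0
  complete : ∀ f : Plane → ℝ, MemLp f 2 (volume.restrict P) → (∀ i, ∫ x in P, f x * w i x = 0) →
    f =ᵐ[volume.restrict P] 0

theorem isFiniteMeasure_restrict_of_isBounded {P : Set Plane} (h : Bornology.IsBounded P) :
    IsFiniteMeasure ((volume : Measure Plane).restrict P) :=
  ⟨by simpa using h.measure_lt_top⟩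

theorem Continuous.memLp_restrict_of_isBounded {P : Set Plane} {F : Type*} [NormedAddCommGroup F]
    {g : Plane → F} (hg : Continuous g) (h : Bornology.IsBounded P) (p : ℝ≥0∞) :
    MemLp g p (volume.restrict P) := by
  have := isFiniteMeasure_restrict_of_isBounded h
  obtain ⟨C, hC⟩ := h.isCompact_closure.exists_bound_of_continuousOn hg.continuousOn
  have hK : MemLp g p (volume.restrict (closure P)) := by
    have := isFiniteMeasure_restrict_of_isBounded h.closure
    refine MemLp.of_bound hg.aestronglyMeasurable C ?_
    filter_upwards [ae_restrict_mem isClosed_closure.measurableSet] with x hx using hC x hx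
  exact hK.mono_measure (Measure.restrict_mono subset_closure le_rfl)

theorem IsTestFunction.mono {P Ω : Set Plane} {φ : Plane → ℝ} (hφ : IsTestFunction P φ)
    (h : P ⊆ Ω) : IsTestFunction Ω φ :=
  ⟨hφ.1, hφ.2.1, hφ.2.2.trans h⟩

theorem IsTestFunction.eq_zero {P : Set Plane} {φ : Plane → ℝ} (hφ : IsTestFunction P φ)
    {x : Plane} (hx : x ∉ P) : φ x = 0 :=
  image_eq_zero_of_notMem_tsupport fun h => hx (hφ.2.2 h)

theorem IsTestFunction.gradient_eq_zero {P : Set Plane} {φ : Plane → ℝ} (hφ : IsTestFunction P φ)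
    {x : Plane} (hx : x ∉ P) : gradient φ x = 0 := by
  have : fderiv ℝ φ x = 0 := image_eq_zero_of_notMem_tsupport fun h =>
    hx (hφ.2.2 (tsupport_fderiv_subset ℝ h))
  simp [gradient, this]

/-- The support of the truncation avoids the open set `Q`, so it is a closed part of supp ψ inside
`P`, and no singularity arises at ∂P. Thus test functions on a disjoint union split into test
functions on the pieces. -/
theorem IsTestFunction.indicator {P Q : Set Plane} (hP : IsOpen P) (hQ : IsOpen Q)
    (hd : Disjoint P Q) {ψ : Plane → ℝ} (hψ : IsTestFunction (P ∪ Q) ψ) :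
    IsTestFunction P (P.indicator ψ) := by
  have hsub : tsupport (P.indicator ψ) ⊆ tsupport ψ ∩ Qᶜ := by
    refine closure_minimal (fun x hx => ?_) ((isClosed_tsupport ψ).inter hQ.isClosed_compl)
    rw [Function.mem_support, indicator_apply_ne_zero] at hx
    exact ⟨subset_tsupport ψ hx.2, fun h => disjoint_left.1 hd hx.1 h⟩
  have hsubP : tsupport (P.indicator ψ) ⊆ P := fun x hx =>
    (hψ.2.2 (hsub hx).1).resolve_right (hsub hx).2
  refine ⟨contDiff_iff_contDiffAt.2 fun x => ?_,
    hψ.2.1.of_isClosed_subset (isClosed_tsupport _) fun x hx => (hsub hx).1, hsubP⟩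
  by_cases hx : x ∈ P
  · refine hψ.1.contDiffAt.congr_of_eventuallyEq ?_
    filter_upwards [hP.mem_nhds hx] with y hy using indicator_of_mem hy ψ
  · have h0 : (P.indicator ψ) =ᶠ[𝓝 x] 0 :=
      notMem_tsupport_iff_eventuallyEq.1 fun h => hx (hsubP h)
    exact (contDiffAt_const (c := (0 : ℝ))).congr_of_eventuallyEq h0

section Extension

variable {P Q Ω : Set Plane} {ι : Type*} {ev : ι → ℝ} {w : ι → Plane → ℝ}

theorem memLp_indicator_of_isBounded {F : Type*} [NormedAddCommGroup F] (hPo : IsOpen P)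
    (hPb : Bornology.IsBounded P) {g : Plane → F} (hg : Continuous g) :
    MemLp (P.indicator g) 2 (volume.restrict Ω) :=
  ((memLp_indicator_iff_restrict hPo.measurableSet).2
    (hg.memLp_restrict_of_isBounded hPb 2)).restrict Ω

/-- The extension by zero of an eigenfunction, as an element of `L²(Ω)`. -/
def IsEigenfamily.extend (h : IsEigenfamily P ev w) (Ω : Set Plane) (i : ι) : L2 Ω :=
  (memLp_indicator_of_isBounded h.isOpen h.isBounded (h.contDiff i).continuous).toLp
    (P.indicator (w i))

theorem IsEigenfamily.coeFn_extend (h : IsEigenfamily P ev w) (Ω : Set Plane) (i : ι) :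
    h.extend Ω i =ᵐ[volume.restrict Ω] P.indicator (w i) :=
  MemLp.coeFn_toLp _

theorem setIntegral_indicator_of_subset {g : Plane → ℝ} (hPo : IsOpen P) (hPΩ : P ⊆ Ω) :
    ∫ x in Ω, P.indicator g x = ∫ x in P, g x := by
  rw [setIntegral_indicator hPo.measurableSet, inter_eq_self_of_subset_right hPΩ]

theorem eLpNorm_indicator_of_subset {F : Type*} [NormedAddCommGroup F] {g : Plane → F}
    (hPo : IsOpen P) (hPΩ : P ⊆ Ω) :
    eLpNorm (P.indicator g) 2 (volume.restrict Ω) = eLpNorm g 2 (volume.restrict P) := by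
  rw [eLpNorm_indicator_eq_eLpNorm_restrict hPo.measurableSet,
    Measure.restrict_restrict hPo.measurableSet, inter_eq_self_of_subset_left hPΩ]

theorem IsEigenfamily.inner_extend (h : IsEigenfamily P ev w) (hPΩ : P ⊆ Ω) (f : L2 Ω) (i : ι) :
    inner ℝ (h.extend Ω i) f = ∫ x in P, f x * w i x := by
  rw [L2.inner_def, ← setIntegral_indicator_of_subset h.isOpen hPΩ]
  refine integral_congr_ae ?_
  filter_upwards [h.coeFn_extend Ω i] with x hx
  rw [hx]
  by_cases hxP : x ∈ P <;> simp [hxP]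

theorem IsEigenfamily.integral_extend (h : IsEigenfamily P ev w) (hPΩ : P ⊆ Ω) (i : ι) :
    ∫ x in Ω, h.extend Ω i x = ∫ x in P, w i x := by
  rw [← setIntegral_indicator_of_subset h.isOpen hPΩ]
  exact integral_congr_ae (h.coeFn_extend Ω i)

/-- Test functions on `P` are test functions on `Ω`, which gives membership in H¹₀; conversely, a
test function on `Ω` truncates to one on `P`, which gives the weak equation. -/
theorem IsEigenfamily.isNegDirichletLaplacian_extend (h : IsEigenfamily P ev w) (hQ : IsOpen Q)
    (hd : Disjoint P Q) (hΩ : Ω = P ∪ Q) (i : ι) :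
    IsNegDirichletLaplacian Ω (h.extend Ω i) (ev i • h.extend Ω i) := by
  have hPΩ : P ⊆ Ω := hΩ ▸ subset_union_left
  have hG := memLp_indicator_of_isBounded (Ω := Ω) h.isOpen h.isBounded
    (h.contDiff i).continuous_gradient
  refine ⟨hG.toLp (P.indicator (gradient (w i))), ?_, fun ψ hψ => ?_⟩
  · obtain ⟨φ, hφ, h1, h2⟩ := h.approx i
    refine ⟨φ, fun n => (hφ n).mono hPΩ, h1.congr fun n => ?_, h2.congr fun n => ?_⟩
    · rw [← eLpNorm_indicator_of_subset h.isOpen hPΩ]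
      refine eLpNorm_congr_ae ?_
      filter_upwards [h.coeFn_extend Ω i] with x hx
      rw [hx]
      by_cases hxP : x ∈ P
      · simp [hxP]
      · simp [hxP, (hφ n).eq_zero hxP]
    · rw [← eLpNorm_indicator_of_subset h.isOpen hPΩ]
      refine eLpNorm_congr_ae ?_
      filter_upwards [hG.coeFn_toLp] with x hx
      rw [hx]
      by_cases hxP : x ∈ P
      · simp [hxP]
      · simp [hxP, (hφ n).gradient_eq_zero hxP]
  · have hψ' := IsTestFunction.indicator h.isOpen hQ hd (hΩ ▸ hψ)
    calc ∫ x in Ω, inner ℝ (hG.toLp (P.indicator (gradient (w i))) x) (gradient ψ x)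
        = ∫ x in Ω, P.indicator (fun x => inner ℝ (gradient (w i) x) (gradient ψ x)) x := by
          refine integral_congr_ae ?_
          filter_upwards [hG.coeFn_toLp] with x hx
          rw [hx]
          by_cases hxP : x ∈ P <;> simp [hxP]
      _ = ∫ x in P, inner ℝ (gradient (w i) x) (gradient ψ x) :=
          setIntegral_indicator_of_subset h.isOpen hPΩ
      _ = ∫ x in P, inner ℝ (gradient (w i) x) (gradient (P.indicator ψ) x) := by
          refine setIntegral_congr_fun h.isOpen.measurableSet fun x hx => ?_
          have : P.indicator ψ =ᶠ[𝓝 x] ψ := by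
            filter_upwards [h.isOpen.mem_nhds hx] with y hy using indicator_of_mem hy ψ
          simp only [gradient, this.fderiv_eq]
      _ = ev i * ∫ x in P, w i x * P.indicator ψ x := h.weak i _ hψ'
      _ = ev i * ∫ x in P, w i x * ψ x := by
          congr 1
          refine setIntegral_congr_fun h.isOpen.measurableSet fun x hx => ?_
          simp only [indicator_of_mem hx]
      _ = ∫ x in Ω, P.indicator (fun x => ev i * (w i x * ψ x)) x := by
          rw [setIntegral_indicator_of_subset h.isOpen hPΩ, integral_const_mul]
      _ = _ := by
          refine integral_congr_ae ?_
          filter_upwards [h.coeFn_extend Ω i, Lp.coeFn_smul (ev i) (h.extend Ω i)] with x hx hx'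
          rw [hx', Pi.smul_apply, hx]
          by_cases hxP : x ∈ P <;> simp [hxP, mul_assoc]

end Extension

/-- L² of the union is the orthogonal sum of the L² spaces of the pieces, so the zero extensions of
the two families together form a basis. -/
theorem exists_eigenbasis_union {P₁ P₂ : Set Plane} {ι₁ ι₂ : Type*} {ev₁ : ι₁ → ℝ} {ev₂ : ι₂ → ℝ}
    {w₁ : ι₁ → Plane → ℝ} {w₂ : ι₂ → Plane → ℝ} (h₁ : IsEigenfamily P₁ ev₁ w₁)
    (h₂ : IsEigenfamily P₂ ev₂ w₂) (hd : Disjoint P₁ P₂) :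
    ∃ b : HilbertBasis (ι₁ ⊕ ι₂) ℝ (L2 (P₁ ∪ P₂)), IsDirichletEigenbasis b (Sum.elim ev₁ ev₂) ∧
      (∀ i, ∫ x in P₁ ∪ P₂, b (.inl i) x = ∫ x in P₁, w₁ i x) ∧
      ∀ i, ∫ x in P₁ ∪ P₂, b (.inr i) x = ∫ x in P₂, w₂ i x := by
  classical
  have hs₁ : P₁ ⊆ P₁ ∪ P₂ := subset_union_left
  have hs₂ : P₂ ⊆ P₁ ∪ P₂ := subset_union_right
  set v : ι₁ ⊕ ι₂ → L2 (P₁ ∪ P₂) := Sum.elim (h₁.extend _) (h₂.extend _) with hv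
  have hcoe₁ : ∀ i, h₁.extend (P₁ ∪ P₂) i =ᵐ[volume.restrict P₁] w₁ i := fun i => by
    filter_upwards [ae_mono (Measure.restrict_mono hs₁ le_rfl) (h₁.coeFn_extend _ i),
      ae_restrict_mem h₁.isOpen.measurableSet] with x hx hxP
    rw [hx, indicator_of_mem hxP]
  have hcoe₂ : ∀ i, h₂.extend (P₁ ∪ P₂) i =ᵐ[volume.restrict P₂] w₂ i := fun i => by
    filter_upwards [ae_mono (Measure.restrict_mono hs₂ le_rfl) (h₂.coeFn_extend _ i),
      ae_restrict_mem h₂.isOpen.measurableSet] with x hx hxP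
    rw [hx, indicator_of_mem hxP]
  have hcross : ∀ i j, inner ℝ (h₁.extend (P₁ ∪ P₂) i) (h₂.extend (P₁ ∪ P₂) j) = 0 := fun i j => by
    rw [h₁.inner_extend hs₁, ← integral_zero Plane ℝ (μ := volume.restrict P₁)]
    refine integral_congr_ae ?_
    filter_upwards [ae_mono (Measure.restrict_mono hs₁ le_rfl) (h₂.coeFn_extend _ j),
      ae_restrict_mem h₁.isOpen.measurableSet] with x hx hxP
    rw [hx, indicator_of_notMem (disjoint_left.1 hd hxP), zero_mul]
  have hin₁ : ∀ i j, inner ℝ (h₁.extend (P₁ ∪ P₂) i) (h₁.extend (P₁ ∪ P₂) j) =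
      ∫ x in P₁, w₁ j x * w₁ i x := fun i j => by
    rw [h₁.inner_extend hs₁]
    refine integral_congr_ae ?_
    filter_upwards [hcoe₁ j] with x hx
    rw [hx]
  have hin₂ : ∀ i j, inner ℝ (h₂.extend (P₁ ∪ P₂) i) (h₂.extend (P₁ ∪ P₂) j) =
      ∫ x in P₂, w₂ j x * w₂ i x := fun i j => by
    rw [h₂.inner_extend hs₂]
    refine integral_congr_ae ?_
    filter_upwards [hcoe₂ j] with x hx
    rw [hx]
  have hon : Orthonormal ℝ v := by
    rw [orthonormal_iff_ite]
    rintro (i | i) (j | j)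
    · simp only [hv, Sum.elim_inl, hin₁, Sum.inl.injEq]
      split_ifs with hij
      · exact hij ▸ h₁.normalized i
      · exact h₁.orthogonal _ _ (Ne.symm hij)
    · simpa [hv] using hcross i j
    · simpa [hv, real_inner_comm] using hcross j i
    · simp only [hv, Sum.elim_inr, hin₂, Sum.inr.injEq]
      split_ifs with hij
      · exact hij ▸ h₂.normalized i
      · exact h₂.orthogonal _ _ (Ne.symm hij)
  have hcomplete : (Submodule.span ℝ (range v))ᗮ = ⊥ := by
    rw [Submodule.eq_bot_iff]
    intro f hf
    have hf' : ∀ i, inner ℝ (v i) f = 0 := fun i =>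
      hf (v i) (Submodule.subset_span (mem_range_self i))
    have hz₁ := h₁.complete f ((Lp.memLp f).mono_measure (Measure.restrict_mono hs₁ le_rfl))
      fun i => (h₁.inner_extend hs₁ f i).symm.trans (hf' (.inl i))
    have hz₂ := h₂.complete f ((Lp.memLp f).mono_measure (Measure.restrict_mono hs₂ le_rfl))
      fun i => (h₂.inner_extend hs₂ f i).symm.trans (hf' (.inr i))
    rw [Lp.eq_zero_iff_ae_eq_zero]
    exact (ae_restrict_union_iff P₁ P₂ _).2 ⟨hz₁, hz₂⟩
  refine ⟨HilbertBasis.mkOfOrthogonalEqBot hon hcomplete, ⟨?_, ?_, fun s hs => ?_⟩, ?_, ?_⟩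
  · rintro (i | i)
    · exact h₁.nonneg i
    · exact h₂.nonneg i
  · rw [HilbertBasis.coe_mkOfOrthogonalEqBot]
    rintro (i | i)
    · exact h₁.isNegDirichletLaplacian_extend h₂.isOpen hd rfl i
    · exact h₂.isNegDirichletLaplacian_extend h₁.isOpen hd.symm (union_comm _ _) i
  · exact Summable.sum _ (h₁.summable s hs) (h₂.summable s hs)
  · rw [HilbertBasis.coe_mkOfOrthogonalEqBot]
    exact h₁.integral_extend hs₁
  · rw [HilbertBasis.coe_mkOfOrthogonalEqBot]
    exact h₂.integral_extend hs₂

/-! ### Invariance under isometries -/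

section Isometry

variable (g : Plane ≃ᵃⁱ[ℝ] Plane)

theorem AffineIsometryEquiv.measurableEmbedding_plane : MeasurableEmbedding g :=
  g.toHomeomorph.measurableEmbedding

theorem AffineIsometryEquiv.coe_eq_linear_add :
    (g : Plane → Plane) = fun x => g.linearIsometryEquiv x + g 0 := by
  ext1 x
  have := g.map_vadd (0 : Plane) x
  simpa using this

theorem AffineIsometryEquiv.measurePreserving_plane :
    MeasurePreserving g (volume : Measure Plane) volume := by
  have h1 := (measurePreserving_add_right (volume : Measure Plane) (g 0)).comp
    g.linearIsometryEquiv.measurePreserving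
  rw [g.coe_eq_linear_add]
  exact h1

theorem AffineIsometryEquiv.measurePreserving_restrict (P : Set Plane) :
    MeasurePreserving g (volume.restrict P) (volume.restrict (g '' P)) :=
  g.measurePreserving_plane.restrict_image_emb g.measurableEmbedding_plane P

theorem AffineIsometryEquiv.setIntegral_image (P : Set Plane) (f : Plane → ℝ) :
    ∫ x in g '' P, f x = ∫ x in P, f (g x) :=
  ((g.measurePreserving_restrict P).integral_comp g.measurableEmbedding_plane f).symm

theorem AffineIsometryEquiv.eLpNorm_image {F : Type*} [NormedAddCommGroup F] (P : Set Plane)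
    (f : Plane → F) :
    eLpNorm f 2 (volume.restrict (g '' P)) = eLpNorm (fun x => f (g x)) 2 (volume.restrict P) := by
  rw [← (g.measurePreserving_restrict P).map_eq,
    g.measurableEmbedding_plane.eLpNorm_map_measure]
  rfl

theorem AffineIsometryEquiv.contDiff_plane : ContDiff ℝ ∞ g := by
  rw [g.coe_eq_linear_add]
  exact g.linearIsometryEquiv.contDiff.add contDiff_const

theorem AffineIsometryEquiv.gradient_comp {φ : Plane → ℝ} (hφ : Differentiable ℝ φ) (x : Plane) :
    gradient (fun y => φ (g y)) x = g.linearIsometryEquiv.symm (gradient φ (g x)) := by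
  refine ext_inner_right ℝ fun v => ?_
  have hg : HasFDerivAt g (g.linearIsometryEquiv : Plane →L[ℝ] Plane) x := by
    rw [g.coe_eq_linear_add]
    exact (g.linearIsometryEquiv : Plane →L[ℝ] Plane).hasFDerivAt.add_const (g 0)
  have hc : HasFDerivAt (fun y => φ (g y)) _ x := (hφ (g x)).hasFDerivAt.comp x hg
  rw [inner_gradient_eq, hc.fderiv, LinearIsometryEquiv.inner_map_eq_flip, inner_gradient_eq]
  simp

theorem IsTestFunction.comp_isometry {P : Set Plane} {φ : Plane → ℝ} (hφ : IsTestFunction P φ) :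
    IsTestFunction (g ⁻¹' P) (fun x => φ (g x)) :=
  ⟨hφ.1.comp g.contDiff_plane, hφ.2.1.comp_homeomorph g.toHomeomorph,
    (tsupport_comp_subset_preimage φ g.continuous).trans (preimage_mono hφ.2.2)⟩

/-- Isometries preserve area and act on gradients by an orthogonal map, so every integral in the
definition is unchanged. -/
theorem IsEigenfamily.image {P : Set Plane} {ι : Type*} {ev : ι → ℝ} {w : ι → Plane → ℝ}
    (h : IsEigenfamily P ev w) :
    IsEigenfamily (g '' P) ev (fun i x => w i (g.symm x)) where
  isOpen := g.toHomeomorph.isOpenMap _ h.isOpen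
  isBounded := g.lipschitz.isBounded_image h.isBounded
  nonneg := h.nonneg
  summable := h.summable
  contDiff i := (h.contDiff i).comp g.symm.contDiff_plane
  approx i := by
    obtain ⟨φ, hφ, h1, h2⟩ := h.approx i
    refine ⟨fun n x => φ n (g.symm x), fun n => ?_, h1.congr fun n => ?_, h2.congr fun n => ?_⟩
    · have := (hφ n).comp_isometry g.symm
      rwa [← show g '' P = g.symm ⁻¹' P from g.toEquiv.image_eq_preimage_symm P] at this
    · rw [g.eLpNorm_image]
      simp
    · rw [g.eLpNorm_image]
      refine eLpNorm_congr_norm_ae (.of_forall fun x => ?_)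
      rw [g.symm.gradient_comp (hφ n).differentiable,
        g.symm.gradient_comp ((h.contDiff i).differentiable (by simp)), ← map_sub,
        LinearIsometryEquiv.norm_map]
      simp
  weak i ψ hψ := by
    have hψ' : IsTestFunction P (fun x => ψ (g x)) := by
      have := hψ.comp_isometry g
      rwa [preimage_image_eq _ g.injective] at this
    have := h.weak i _ hψ'
    rw [g.setIntegral_image, g.setIntegral_image]
    simp only [AffineIsometryEquiv.symm_apply_apply]
    rw [← this]
    congr 1
    ext1 x
    rw [g.gradient_comp hψ.differentiable,
      g.symm.gradient_comp ((h.contDiff i).differentiable (by simp))]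
    simpa using! g.linearIsometryEquiv.inner_map_eq_flip (gradient (w i) x) (gradient ψ (g x))
  normalized i := by
    rw [g.setIntegral_image]
    simpa using h.normalized i
  orthogonal i j hij := by
    rw [g.setIntegral_image]
    simpa using h.orthogonal i j hij
  complete f hf hz := by
    have h1 := h.complete (fun x => f (g x))
      (hf.comp_measurePreserving (g.measurePreserving_restrict P)) fun i => by
        have := hz i
        rw [g.setIntegral_image] at this
        simpa using this
    rw [Filter.EventuallyEq, ← (g.measurePreserving_restrict P).map_eq,
      g.measurableEmbedding_plane.ae_map_iff]
    exact h1

end Isometry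

/-! ### Density of polynomials in two separating functions -/

/-- `W` is a module over the algebra generated by `c₁` and `c₂`, so f ρ is orthogonal to that
algebra. By Stone–Weierstrass the algebra is dense in C(K), hence f ρ = 0 almost everywhere, and ρ
has no zeros in `P`. -/
theorem ae_eq_zero_of_integral_mul_eq_zero {P K : Set Plane} (hP : IsOpen P) (hK : IsCompact K)
    (hPK : P ⊆ K) {c₁ c₂ : Plane → ℝ} (hc₁ : Continuous c₁) (hc₂ : Continuous c₂)
    (hsep : ∀ x ∈ K, ∀ y ∈ K, c₁ x = c₁ y → c₂ x = c₂ y → x = y) (W : Submodule ℝ (Plane → ℝ))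
    (hWc : ∀ w ∈ W, Continuous w) (hW₁ : ∀ w ∈ W, c₁ * w ∈ W) (hW₂ : ∀ w ∈ W, c₂ * w ∈ W)
    {f : Plane → ℝ} (hf : IntegrableOn f P) (hz : ∀ w ∈ W, ∫ x in P, f x * w x = 0)
    {ρ : Plane → ℝ} (hρW : ρ ∈ W) (hρ : ∀ x ∈ P, ρ x ≠ 0) : f =ᵐ[volume.restrict P] 0 := by
  have : CompactSpace K := isCompact_iff_compactSpace.1 hK
  let C₁ : C(K, ℝ) := ⟨fun x => c₁ x, by fun_prop⟩
  let C₂ : C(K, ℝ) := ⟨fun x => c₂ x, by fun_prop⟩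
  let A : Subalgebra ℝ C(K, ℝ) := Algebra.adjoin ℝ {C₁, C₂}
  have hA : A.SeparatesPoints := by
    intro x y hxy
    by_cases h : c₁ x = c₁ y
    · refine ⟨C₂, ⟨C₂, Algebra.subset_adjoin (by simp), rfl⟩, fun h' => hxy ?_⟩
      exact Subtype.ext (hsep x x.2 y y.2 h h')
    · exact ⟨C₁, ⟨C₁, Algebra.subset_adjoin (by simp), rfl⟩, h⟩
  -- Elements of `A` live only on `K`, whereas `W` consists of functions on the plane; each is given
  -- a continuous extension that multiplies `W` into itself.
  have hlift : ∀ q ∈ A, ∃ Q : Plane → ℝ, Continuous Q ∧ (∀ w ∈ W, Q * w ∈ W) ∧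
      ∀ x : K, q x = Q x := by
    intro q hq
    induction hq using Algebra.adjoin_induction with
    | mem q hq =>
      rcases hq with rfl | rfl
      · exact ⟨c₁, hc₁, hW₁, fun _ => rfl⟩
      · exact ⟨c₂, hc₂, hW₂, fun _ => rfl⟩
    | algebraMap r =>
      exact ⟨fun _ => r, continuous_const, fun w hw => W.smul_mem r hw, fun _ => rfl⟩
    | add p q _ _ hp hq =>
      obtain ⟨P', h1, h2, h3⟩ := hp
      obtain ⟨Q', h1', h2', h3'⟩ := hq
      refine ⟨P' + Q', h1.add h1', fun w hw => ?_, fun x => by simp [h3, h3']⟩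
      rw [add_mul]
      exact W.add_mem (h2 w hw) (h2' w hw)
    | mul p q _ _ hp hq =>
      obtain ⟨P', h1, h2, h3⟩ := hp
      obtain ⟨Q', h1', h2', h3'⟩ := hq
      refine ⟨P' * Q', h1.mul h1', fun w hw => ?_, fun x => by simp [h3, h3']⟩
      rw [mul_assoc]
      exact h2 _ (h2' w hw)
  have hint : ∀ {g : Plane → ℝ}, Continuous g → IntegrableOn (fun x => f x * g x) P := by
    intro g hg
    obtain ⟨B, hB⟩ := hK.exists_bound_of_continuousOn hg.continuousOn
    refine Integrable.mul_bdd (c := B) hf hg.aestronglyMeasurable ?_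
    filter_upwards [ae_restrict_mem hP.measurableSet] with x hx using hB x (hPK hx)
  have hFi : IntegrableOn (fun x => f x * ρ x) P := hint (hWc ρ hρW)
  have hF : ∀ᵐ x, x ∈ P → f x * ρ x = 0 := by
    refine hP.ae_eq_zero_of_integral_contDiff_smul_eq_zero hFi.locallyIntegrableOn
      fun g hg _ hgs => ?_
    have hgz : ∀ x, x ∉ P → g x • (f x * ρ x) = 0 := fun x hx => by
      rw [image_eq_zero_of_notMem_tsupport fun h => hx (hgs h), zero_smul]
    rw [← setIntegral_eq_integral_of_forall_compl_eq_zero hgz]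
    have hbound : ∀ ε : ℝ, 0 < ε →
        |∫ x in P, g x • (f x * ρ x)| ≤ ε * ∫ x in P, |f x * ρ x| := by
      intro ε hε
      obtain ⟨q, hq⟩ := ContinuousMap.exists_mem_subalgebra_near_continuousMap_of_separatesPoints
        A hA ⟨fun x : K => g x, hg.continuous.comp continuous_subtype_val⟩ ε hε
      obtain ⟨Q, hQc, hQW, hQ⟩ := hlift q q.2
      have hzero : ∫ x in P, f x * (Q * ρ) x = 0 := hz _ (hQW ρ hρW)
      have hgi : IntegrableOn (fun x => g x • (f x * ρ x)) P :=
        (hint (hg.continuous.mul (hWc ρ hρW))).congr (.of_forall fun x => by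
          simp only [smul_eq_mul, Pi.mul_apply]; ring)
      have hQi : IntegrableOn (fun x => f x * (Q * ρ) x) P := hint (hQc.mul (hWc ρ hρW))
      rw [← sub_zero (∫ x in P, g x • (f x * ρ x)), ← hzero, ← integral_sub hgi hQi,
        ← Real.norm_eq_abs, ← integral_const_mul]
      refine norm_integral_le_of_norm_le (hFi.abs.const_mul ε) ?_
      filter_upwards [ae_restrict_mem hP.measurableSet] with x hx
      have h1 := ((q : C(K, ℝ)) - ⟨fun x : K => g x,
        hg.continuous.comp continuous_subtype_val⟩).norm_coe_le_norm ⟨x, hPK hx⟩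
      have h2 : |Q x - g x| ≤ ε := by
        refine le_trans ?_ hq.le
        simpa [hQ] using h1
      have h3 : g x • (f x * ρ x) - f x * (Q * ρ) x = -((Q x - g x) * (f x * ρ x)) := by
        simp only [smul_eq_mul, Pi.mul_apply]; ring
      rw [h3, norm_neg, norm_mul]
      exact mul_le_mul_of_nonneg_right h2 (abs_nonneg _)
    set I := ∫ x in P, g x • (f x * ρ x)
    set J := ∫ x in P, |f x * ρ x|
    have hJ : 0 ≤ J := integral_nonneg fun x => abs_nonneg _
    by_contra hI
    have hI' := abs_pos.2 hI
    -- This ε gives |I| (J + 1) ≤ |I| J, which is absurd; the `+ 1` covers J = 0.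
    have := hbound (|I| / (J + 1)) (by positivity)
    rw [div_mul_eq_mul_div, le_div_iff₀ (by positivity)] at this
    nlinarith
  rw [Filter.EventuallyEq, ae_restrict_iff' hP.measurableSet]
  filter_upwards [hF] with x hx hxP
  exact (mul_eq_zero.1 (hx hxP)).resolve_right (hρ x hxP)

/-! ### Cutoffs in convex polygons -/

theorem tendsto_eLpNorm_zero_of_bounded {α F : Type*} [MeasurableSpace α] {μ : Measure α}
    [IsFiniteMeasure μ] [NormedAddCommGroup F] {f : ℕ → α → F}
    (hm : ∀ n, AEStronglyMeasurable (f n) μ) {C : ℝ} (hC : ∀ n, ∀ᵐ x ∂μ, ‖f n x‖ ≤ C)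
    (hf : ∀ᵐ x ∂μ, Tendsto (fun n => f n x) atTop (𝓝 0)) :
    Tendsto (fun n => eLpNorm (f n) 2 μ) atTop (𝓝 0) := by
  have key : Tendsto (fun n => ∫⁻ x, ‖f n x‖ₑ ^ (2 : ℝ) ∂μ) atTop (𝓝 (∫⁻ _, 0 ∂μ)) := by
    refine tendsto_lintegral_of_dominated_convergence' (fun _ => ENNReal.ofReal C ^ (2 : ℝ))
      (fun n => (hm n).enorm.pow_const _) (fun n => ?_) ?_ ?_
    · filter_upwards [hC n] with x hx
      refine ENNReal.rpow_le_rpow ?_ (by norm_num)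
      rw [← ofReal_norm]
      exact ENNReal.ofReal_le_ofReal hx
    · rw [lintegral_const]
      exact ENNReal.mul_ne_top (by finiteness) (measure_ne_top _ _)
    · filter_upwards [hf] with x hx
      have := (ENNReal.continuous_rpow_const (y := 2)).tendsto _ |>.comp hx.enorm
      simpa [Function.comp_def] using this
  rw [lintegral_zero] at key
  have := (ENNReal.continuous_rpow_const (y := 1 / 2)).tendsto _ |>.comp key
  simp only [eLpNorm_eq_lintegral_rpow_enorm_toReal two_ne_zero ENNReal.ofNat_ne_top,
    ENNReal.toReal_ofNat]
  simpa [Function.comp_def] using this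

/-- A smooth cutoff: `0` on `(-∞, 1]` and `1` on `[2, ∞)`. -/
def smoothCutoff (s : ℝ) : ℝ := Real.smoothTransition (s - 1)

theorem smoothCutoff_contDiff : ContDiff ℝ ∞ smoothCutoff :=
  Real.smoothTransition.contDiff.comp (contDiff_id.sub contDiff_const)

theorem smoothCutoff_nonneg (s : ℝ) : 0 ≤ smoothCutoff s := Real.smoothTransition.nonneg _

theorem smoothCutoff_le_one (s : ℝ) : smoothCutoff s ≤ 1 := Real.smoothTransition.le_one _

theorem smoothCutoff_eq_zero {s : ℝ} (h : s ≤ 1) : smoothCutoff s = 0 :=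
  Real.smoothTransition.zero_of_nonpos (by linarith)

theorem smoothCutoff_eq_one {s : ℝ} (h : 2 ≤ s) : smoothCutoff s = 1 :=
  Real.smoothTransition.one_of_one_le (by linarith)

/-- The derivative is supported in [1, 2]. With s = N d, the factor N from differentiating a cutoff
at scale 1/N is paid for by the distance d to the side. -/
theorem exists_bound_mul_deriv_smoothCutoff :
    ∃ M, 0 ≤ M ∧ ∀ s, |s * deriv smoothCutoff s| ≤ M := by
  have hc : Continuous (deriv smoothCutoff) := smoothCutoff_contDiff.continuous_deriv (by simp)
  obtain ⟨M, hM⟩ := Continuous.bounded_above_of_compact_support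
    (f := fun s => s * deriv smoothCutoff s) (by fun_prop) (by
      refine HasCompactSupport.intro (isCompact_Icc (a := (1 : ℝ)) (b := 2)) fun s hs => ?_
      rw [mem_Icc, not_and_or, not_le, not_le] at hs
      have : deriv smoothCutoff s = 0 := by
        rcases hs with hs | hs
        · have : smoothCutoff =ᶠ[𝓝 s] fun _ => 0 := by
            filter_upwards [Iio_mem_nhds hs] with r hr using smoothCutoff_eq_zero (le_of_lt hr)
          rw [this.deriv_eq, deriv_const]
        · have : smoothCutoff =ᶠ[𝓝 s] fun _ => 1 := by
            filter_upwards [Ioi_mem_nhds hs] with r hr using smoothCutoff_eq_one (le_of_lt hr)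
          rw [this.deriv_eq, deriv_const]
      rw [this, mul_zero])
  exact ⟨M, (norm_nonneg _).trans (hM 0), hM⟩

section Polygon

variable {k : ℕ} (f : Fin k → StrongDual ℝ Plane) (γ : Fin k → ℝ)

/-- The cutoff to the points of a polygon that are far from all sides on the scale `1 / N`. -/
def polygonCutoff (N : ℝ) (x : Plane) : ℝ := ∏ i, smoothCutoff (N * (f i x + γ i))

theorem polygonCutoff_contDiff (N : ℝ) : ContDiff ℝ ∞ (polygonCutoff f γ N) :=
  contDiff_prod fun i _ => smoothCutoff_contDiff.comp
    (contDiff_const.mul ((f i).contDiff.add contDiff_const))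

theorem polygonCutoff_nonneg (N : ℝ) (x : Plane) : 0 ≤ polygonCutoff f γ N x :=
  Finset.prod_nonneg fun _ _ => smoothCutoff_nonneg _

theorem polygonCutoff_le_one (N : ℝ) (x : Plane) : polygonCutoff f γ N x ≤ 1 :=
  Finset.prod_le_one (fun _ _ => smoothCutoff_nonneg _) fun _ _ => smoothCutoff_le_one _

/-- Product rule; the undifferentiated factors lie in [0, 1]. -/
theorem norm_fderiv_polygonCutoff_le {N : ℝ} (hN : 0 ≤ N) (x : Plane) :
    ‖fderiv ℝ (polygonCutoff f γ N) x‖ ≤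
      ∑ i, |deriv smoothCutoff (N * (f i x + γ i))| * N * ‖f i‖ := by
  have h : ∀ i, HasFDerivAt (fun x => smoothCutoff (N * (f i x + γ i)))
      (deriv smoothCutoff (N * (f i x + γ i)) • N • f i) x := fun i =>
    ((smoothCutoff_contDiff.differentiable (by simp) _).hasDerivAt).comp_hasFDerivAt x
      (((f i).hasFDerivAt.add_const (γ i)).const_mul N)
  have hp := HasFDerivAt.finsetProd (u := Finset.univ) fun i _ => h i
  have he : polygonCutoff f γ N = (∏ i, fun x => smoothCutoff (N * (f i x + γ i))) := by
    ext x
    simp [polygonCutoff]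
  rw [he, HasFDerivAt.fderiv (by simpa [Finset.prod_fn] using hp)]
  refine (norm_sum_le _ _).trans (Finset.sum_le_sum fun i _ => ?_)
  rw [norm_smul, norm_smul, norm_smul, Real.norm_eq_abs (deriv _ _), norm_of_nonneg hN, mul_assoc]
  refine mul_le_of_le_one_left (by positivity) ?_
  rw [norm_of_nonneg (Finset.prod_nonneg fun _ _ => smoothCutoff_nonneg _)]
  exact Finset.prod_le_one (fun _ _ => smoothCutoff_nonneg _) fun _ _ => smoothCutoff_le_one _

/-- A smooth function that vanishes on the sides of a bounded convex polygon is in `H¹₀`. -/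
theorem exists_testFunction_approx_of_polygon {P : Set Plane}
    (hP : P = {x | ∀ i, 0 < f i x + γ i}) (hb : Bornology.IsBounded P) {w : Plane → ℝ}
    (hw : ContDiff ℝ ∞ w) {C : ℝ} (hC : ∀ x ∈ P, ∀ i, |w x| ≤ C * (f i x + γ i)) :
    ∃ φ : ℕ → Plane → ℝ, (∀ n, IsTestFunction P (φ n)) ∧
    Tendsto (fun n => eLpNorm (fun x => φ n x - w x) 2 (volume.restrict P)) atTop (𝓝 0) ∧
    Tendsto (fun n => eLpNorm (fun x => gradient (φ n) x - gradient w x) 2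
      (volume.restrict P)) atTop (𝓝 0) := by
  have := isFiniteMeasure_restrict_of_isBounded hb
  have hPo : IsOpen P := by
    rw [hP, ofPred_forall]
    exact isOpen_iInter_of_finite fun i => isOpen_lt continuous_const (by fun_prop)
  have hmem : ∀ {x}, x ∈ P ↔ ∀ i, 0 < f i x + γ i := fun {x} => by rw [hP]; rfl
  obtain ⟨B₀, hB₀⟩ := hb.isCompact_closure.exists_bound_of_continuousOn hw.continuous.continuousOn
  obtain ⟨B₁, hB₁⟩ := hb.isCompact_closure.exists_bound_of_continuousOn
    hw.continuous_gradient.continuousOn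
  obtain ⟨M, hM0, hM⟩ := exists_bound_mul_deriv_smoothCutoff
  set N : ℕ → ℝ := fun n => n + 1 with hNdef
  have hN : ∀ n, 0 < N n := fun n => by positivity
  have hNlim : Tendsto N atTop atTop :=
    tendsto_atTop_add_const_right _ _ tendsto_natCast_atTop_atTop
  set φ : ℕ → Plane → ℝ := fun n x => polygonCutoff f γ (N n) x * w x with hφ
  have hφc : ∀ n, ContDiff ℝ ∞ (φ n) := fun n => (polygonCutoff_contDiff f γ _).mul hw
  have htest : ∀ n, IsTestFunction P (φ n) := by
    intro n
    have hsub : tsupport (φ n) ⊆ {x | ∀ i, 1 ≤ N n * (f i x + γ i)} := by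
      refine closure_minimal (fun x hx => ?_) ?_
      · intro i
        by_contra! hi
        refine hx ?_
        simp only [hφ, polygonCutoff]
        rw [Finset.prod_eq_zero (Finset.mem_univ i) (smoothCutoff_eq_zero hi.le), zero_mul]
      · rw [ofPred_forall]
        exact isClosed_iInter fun i => isClosed_le continuous_const (by fun_prop)
    have hsub' : tsupport (φ n) ⊆ P := fun x hx => hmem.2 fun i =>
      pos_of_mul_pos_right (one_pos.trans_le (hsub hx i)) (hN n).le
    exact ⟨hφc n, Metric.isCompact_of_isClosed_isBounded (isClosed_tsupport _) (hb.subset hsub'),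
      hsub'⟩
  -- At a fixed point the cutoff is eventually 1 in a whole neighbourhood, so function and gradient
  -- both agree with those of `w`; dominated convergence then needs only uniform bounds.
  have hev : ∀ x ∈ P, ∀ᶠ n in atTop, φ n =ᶠ[𝓝 x] w := by
    intro x hx
    have : ∀ᶠ n in atTop, ∀ i, 2 < N n * (f i x + γ i) := eventually_all.2 fun i =>
      (hNlim.atTop_mul_const (hmem.1 hx i)).eventually_gt_atTop 2
    filter_upwards [this] with n hn
    have hnb : ∀ᶠ y in 𝓝 x, ∀ i, 2 < N n * (f i y + γ i) := eventually_all.2 fun i =>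
      (isOpen_lt continuous_const (by fun_prop)).mem_nhds (hn i)
    filter_upwards [hnb] with y hy
    simp only [hφ, polygonCutoff]
    rw [Finset.prod_eq_one fun i _ => smoothCutoff_eq_one (hy i).le, one_mul]
  refine ⟨φ, htest, ?_, ?_⟩
  · refine tendsto_eLpNorm_zero_of_bounded (C := B₀)
      (fun n => ((hφc n).continuous.sub hw.continuous).aestronglyMeasurable) (fun n => ?_) ?_
    · filter_upwards [ae_restrict_mem hPo.measurableSet] with x hx
      have h1 : φ n x - w x = (polygonCutoff f γ (N n) x - 1) * w x := by simp only [hφ]; ring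
      rw [h1, norm_mul]
      refine (mul_le_of_le_one_left (norm_nonneg _) ?_).trans (hB₀ x (subset_closure hx))
      rw [Real.norm_eq_abs, abs_le]
      constructor <;> linarith [polygonCutoff_nonneg f γ (N n) x, polygonCutoff_le_one f γ (N n) x]
    · filter_upwards [ae_restrict_mem hPo.measurableSet] with x hx
      refine tendsto_const_nhds.congr' ?_
      filter_upwards [hev x hx] with n hn
      rw [hn.self_of_nhds, sub_self]
  -- The three summands bound χ∇w, w∇χ and ∇w. The middle one is uniform in `n` because |w| ≤ C d_i
  -- and N d_i |χ'(N d_i)| ≤ M.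
  · refine tendsto_eLpNorm_zero_of_bounded (C := B₁ + (∑ i, C * M * ‖f i‖) + B₁)
      (fun n => ((hφc n).continuous_gradient.sub hw.continuous_gradient).aestronglyMeasurable)
      (fun n => ?_) ?_
    · filter_upwards [ae_restrict_mem hPo.measurableSet] with x hx
      refine (norm_sub_le _ _).trans (add_le_add ?_ (hB₁ x (subset_closure hx)))
      have hχ := (polygonCutoff_contDiff f γ (N n)).differentiable (by simp) x
      have hwd := hw.differentiable (by simp) x
      rw [norm_gradient_eq, show φ n = polygonCutoff f γ (N n) * w from rfl, fderiv_mul hχ hwd]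
      refine (norm_add_le _ _).trans (add_le_add ?_ ?_)
      · rw [norm_smul, norm_of_nonneg (polygonCutoff_nonneg _ _ _ _), ← norm_gradient_eq]
        exact (mul_le_of_le_one_left (norm_nonneg _) (polygonCutoff_le_one _ _ _ _)).trans
          (hB₁ x (subset_closure hx))
      · rw [norm_smul]
        refine (mul_le_mul_of_nonneg_left (norm_fderiv_polygonCutoff_le f γ (hN n).le x)
          (norm_nonneg _)).trans ?_
        rw [Finset.mul_sum]
        refine Finset.sum_le_sum fun i _ => ?_
        rw [← mul_assoc]
        refine mul_le_mul_of_nonneg_right ?_ (norm_nonneg _)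
        have hpos := hmem.1 hx i
        have hC0 : 0 ≤ C := by
          by_contra! h
          exact absurd ((abs_nonneg _).trans (hC x hx i))
            (not_le.2 (mul_neg_of_neg_of_pos h hpos))
        calc ‖w x‖ * (|deriv smoothCutoff (N n * (f i x + γ i))| * N n)
            ≤ C * (f i x + γ i) * (|deriv smoothCutoff (N n * (f i x + γ i))| * N n) :=
              mul_le_mul_of_nonneg_right (hC x hx i) (mul_nonneg (abs_nonneg _) (hN n).le)
          _ = C * |N n * (f i x + γ i) * deriv smoothCutoff (N n * (f i x + γ i))| := by
              rw [abs_mul, abs_of_pos (mul_pos (hN n) hpos)]; ring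
          _ ≤ C * M := mul_le_mul_of_nonneg_left (hM _) hC0
    · filter_upwards [ae_restrict_mem hPo.measurableSet] with x hx
      refine tendsto_const_nhds.congr' ?_
      filter_upwards [hev x hx] with n hn
      simp only [gradient, hn.fderiv_eq, sub_self]

end Polygon

/-! ### Integration by parts -/

theorem inner_gradient_gradient (w ψ : Plane → ℝ) (x : Plane) :
    inner ℝ (gradient w x) (gradient ψ x) =
      ∑ i : Fin 2, fderiv ℝ w x (EuclideanSpace.single i 1) *
        fderiv ℝ ψ x (EuclideanSpace.single i 1) := by
  rw [← (EuclideanSpace.basisFun (Fin 2) ℝ).sum_inner_mul_inner]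
  refine Finset.sum_congr rfl fun i _ => ?_
  rw [EuclideanSpace.basisFun_apply, inner_gradient_eq, real_inner_comm, inner_gradient_eq]

/-- Since ψ has compact support in `P`, both integrals extend to the whole plane, and integration by
parts there has no boundary term. -/
theorem setIntegral_inner_gradient_eq {P : Set Plane} {w : Plane → ℝ} {D : Fin 2 → Plane → ℝ}
    (hD : ∀ i, ContDiff ℝ ∞ (D i))
    (hwD : ∀ i x, fderiv ℝ w x (EuclideanSpace.single i 1) = D i x) {μ : ℝ}
    (hμ : ∀ x, ∑ i, fderiv ℝ (D i) x (EuclideanSpace.single i 1) = -(μ * w x)) {ψ : Plane → ℝ}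
    (hψ : IsTestFunction P ψ) :
    ∫ x in P, inner ℝ (gradient w x) (gradient ψ x) = μ * ∫ x in P, w x * ψ x := by
  rw [setIntegral_eq_integral_of_forall_compl_eq_zero fun x hx => by
      rw [hψ.gradient_eq_zero hx, inner_zero_right],
    setIntegral_eq_integral_of_forall_compl_eq_zero fun x hx => by
      rw [hψ.eq_zero hx, mul_zero]]
  have hψd : ∀ i, Continuous fun x => fderiv ℝ ψ x (EuclideanSpace.single i 1) := fun i =>
    (hψ.1.continuous_fderiv (by simp)).clm_apply continuous_const
  have hψs : ∀ i, HasCompactSupport fun x => fderiv ℝ ψ x (EuclideanSpace.single i 1) := fun i =>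
    hψ.2.1.fderiv_apply (𝕜 := ℝ) (EuclideanSpace.single i 1)
  have hDd : ∀ i, Continuous fun x => fderiv ℝ (D i) x (EuclideanSpace.single i 1) := fun i =>
    ((hD i).continuous_fderiv (by simp)).clm_apply continuous_const
  have hint : ∀ i, Integrable fun x => D i x * fderiv ℝ ψ x (EuclideanSpace.single i 1) := fun i =>
    ((hD i).continuous.mul (hψd i)).integrable_of_hasCompactSupport (hψs i).mul_left
  have hint' : ∀ i, Integrable fun x => fderiv ℝ (D i) x (EuclideanSpace.single i 1) * ψ x :=
    fun i => ((hDd i).mul hψ.1.continuous).integrable_of_hasCompactSupport hψ.2.1.mul_left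
  have hparts : ∀ i, ∫ x, D i x * fderiv ℝ ψ x (EuclideanSpace.single i 1) =
      -∫ x, fderiv ℝ (D i) x (EuclideanSpace.single i 1) * ψ x := fun i =>
    integral_mul_fderiv_eq_neg_fderiv_mul_of_integrable (hint' i) (hint i)
      (((hD i).continuous.mul hψ.1.continuous).integrable_of_hasCompactSupport hψ.2.1.mul_left)
      (fun x _ => (hD i).differentiable (by simp) x) fun x _ => hψ.differentiable x
  simp only [inner_gradient_gradient, hwD]
  rw [integral_finsetSum _ fun i _ => hint i]
  simp only [hparts]
  rw [Finset.sum_neg_distrib, ← integral_finsetSum _ fun i _ => hint' i, ← integral_neg,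
    ← integral_const_mul]
  refine integral_congr_ae (.of_forall fun x => ?_)
  simp only
  rw [← Finset.sum_mul, hμ]
  ring

/-- The standing waves on the plane with wave numbers `k` and `l`. -/
def standingWave (α β k l : ℝ) (x : Plane) : ℝ :=
  α * (sin (k * x 0) * sin (l * x 1)) + β * (sin (l * x 0) * sin (k * x 1))

theorem standingWave_contDiff (α β k l : ℝ) : ContDiff ℝ ∞ (standingWave α β k l) := by
  unfold standingWave
  fun_prop

theorem hasFDerivAt_coord (i : Fin 2) (x : Plane) :
    HasFDerivAt (fun x : Plane => x i) (EuclideanSpace.proj i : StrongDual ℝ Plane) x :=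
  (EuclideanSpace.proj i : StrongDual ℝ Plane).hasFDerivAt

theorem setIntegral_inner_gradient_standingWave {P : Set Plane} (α β k l : ℝ) {ψ : Plane → ℝ}
    (hψ : IsTestFunction P ψ) :
    ∫ x in P, inner ℝ (gradient (standingWave α β k l) x) (gradient ψ x) =
      (k ^ 2 + l ^ 2) * ∫ x in P, standingWave α β k l x * ψ x := by
  have hs : ∀ (r : ℝ) (i : Fin 2) (x : Plane), HasFDerivAt (fun x : Plane => sin (r * x i))
      (cos (r * x i) • r • (EuclideanSpace.proj i : StrongDual ℝ Plane)) x := fun r i x =>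
    ((hasFDerivAt_coord i x).const_mul r).sin
  have hc : ∀ (r : ℝ) (i : Fin 2) (x : Plane), HasFDerivAt (fun x : Plane => cos (r * x i))
      (-sin (r * x i) • r • (EuclideanSpace.proj i : StrongDual ℝ Plane)) x := fun r i x =>
    ((hasFDerivAt_coord i x).const_mul r).cos
  -- The two partial derivatives of the standing wave.
  let D : Fin 2 → Plane → ℝ := ![
    fun x => α * k * (cos (k * x 0) * sin (l * x 1)) + β * l * (cos (l * x 0) * sin (k * x 1)),
    fun x => α * l * (sin (k * x 0) * cos (l * x 1)) + β * k * (sin (l * x 0) * cos (k * x 1))]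
  refine setIntegral_inner_gradient_eq (D := D) (fun i => ?_)
    (fun i x => ?_) (fun x => ?_) hψ
  · fin_cases i <;> simp only [D] <;> dsimp <;> fun_prop
  · have h : HasFDerivAt (standingWave α β k l) _ x :=
      (((hs k 0 x).mul (hs l 1 x)).const_mul α).add (((hs l 0 x).mul (hs k 1 x)).const_mul β)
    rw [h.fderiv]
    fin_cases i <;> simp [D] <;> ring
  · have h0 : HasFDerivAt (D 0) _ x :=
      (((hc k 0 x).mul (hs l 1 x)).const_mul (α * k)).add
        (((hc l 0 x).mul (hs k 1 x)).const_mul (β * l))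
    have h1 : HasFDerivAt (D 1) _ x :=
      (((hs k 0 x).mul (hc l 1 x)).const_mul (α * l)).add
        (((hs l 0 x).mul (hc k 1 x)).const_mul (β * k))
    rw [Fin.sum_univ_two, h0.fderiv, h1.fderiv]
    simp [standingWave]
    ring

/-! ### Trigonometric integrals -/

theorem integral_Ioo_cos_int_mul {a : ℝ} (ha : 0 < a) {j : ℤ} (hj : j ≠ 0) :
    ∫ t in Ioo 0 a, cos (j * π / a * t) = 0 := by
  have hj' : (j : ℝ) * π / a ≠ 0 := by positivity
  rw [← integral_Ioc_eq_integral_Ioo, ← intervalIntegral.integral_of_le ha.le,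
    intervalIntegral.integral_comp_mul_left _ hj', integral_cos,
    show (j : ℝ) * π / a * a = j * π by field_simp]
  simp

theorem integral_Ioo_sin_mul_sin {a : ℝ} (ha : 0 < a) {m n : ℕ} (hm : 0 < m) :
    ∫ t in Ioo 0 a, sin (m * π / a * t) * sin (n * π / a * t) = if m = n then a / 2 else 0 := by
  have hint : ∀ r : ℝ, IntegrableOn (fun t => cos (r * π / a * t)) (Ioo 0 a) := fun r =>
    ((by fun_prop : Continuous fun t => cos (r * π / a * t)).integrableOn_Icc).mono_set
      Ioo_subset_Icc_self
  -- Product-to-sum, with integer frequencies because m - n may be negative.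
  have hsum : ∀ t, sin (m * π / a * t) * sin (n * π / a * t) =
      (cos (((m : ℤ) - n : ℤ) * π / a * t) - cos (((m : ℤ) + n : ℤ) * π / a * t)) / 2 := by
    intro t
    rw [show (((m : ℤ) - n : ℤ) : ℝ) * π / a * t = m * π / a * t - n * π / a * t by
        push_cast; ring,
      show (((m : ℤ) + n : ℤ) : ℝ) * π / a * t = m * π / a * t + n * π / a * t by
        push_cast; ring, cos_sub, cos_add]
    ring
  simp only [hsum]
  rw [integral_div, integral_sub (hint _) (hint _),
    integral_Ioo_cos_int_mul ha (j := (m : ℤ) + n) (by omega)]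
  split_ifs with h
  · subst h
    simp [ha.le]
  · rw [integral_Ioo_cos_int_mul ha (by omega)]
    simp

theorem integral_Ioo_sin_pi_div {a : ℝ} (ha : 0 < a) :
    ∫ t in Ioo 0 a, sin (π / a * t) = 2 * a / π := by
  rw [← integral_Ioc_eq_integral_Ioo, ← intervalIntegral.integral_of_le ha.le,
    intervalIntegral.integral_comp_mul_left (fun t => sin t) (by positivity), integral_sin,
    show π / a * a = π by field_simp]
  simp
  field_simp
  norm_num

/-! ### Integrals over rectangles and triangles in coordinates -/

/-- The coordinates of the plane. -/
def planeCoord : Plane ≃ᵐ ℝ × ℝ :=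
  (MeasurableEquiv.toLp 2 (Fin 2 → ℝ)).symm.trans MeasurableEquiv.finTwoArrow

theorem planeCoord_apply (x : Plane) : planeCoord x = (x 0, x 1) := rfl

theorem measurePreserving_planeCoord : MeasurePreserving planeCoord volume volume :=
  (volume_preserving_finTwoArrow ℝ).comp
    (EuclideanSpace.volume_preserving_symm_measurableEquiv_toLp (Fin 2))

theorem setIntegral_planeCoord (s : Set (ℝ × ℝ)) (F : ℝ × ℝ → ℝ) :
    ∫ x in planeCoord ⁻¹' s, F (x 0, x 1) = ∫ p in s, F p :=
  measurePreserving_planeCoord.setIntegral_preimage_emb planeCoord.measurableEmbedding F s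

theorem openRectangle_eq_preimage (a b : ℝ) :
    openRectangle a b = planeCoord ⁻¹' (Ioo 0 a ×ˢ Ioo 0 b) := by
  ext x
  simp [openRectangle, planeCoord_apply, and_assoc]

theorem setIntegral_openRectangle_mul (a b : ℝ) (F G : ℝ → ℝ) :
    ∫ x in openRectangle a b, F (x 0) * G (x 1) =
      (∫ t in Ioo 0 a, F t) * ∫ t in Ioo 0 b, G t := by
  rw [openRectangle_eq_preimage, setIntegral_planeCoord _ fun p => F p.1 * G p.2,
    Measure.volume_eq_prod, setIntegral_prod_mul]

/-- The right isosceles triangle in coordinates. -/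
def triangleCoord (c : ℝ) : Set (ℝ × ℝ) := {p | 0 < p.2 ∧ p.2 < p.1 ∧ p.1 < c}

theorem openRightIsoscelesTriangle_eq_preimage (c : ℝ) :
    openRightIsoscelesTriangle c = planeCoord ⁻¹' triangleCoord c := rfl

theorem measurableSet_triangleCoord (c : ℝ) : MeasurableSet (triangleCoord c) :=
  (measurableSet_lt measurable_const measurable_snd).inter
    ((measurableSet_lt measurable_snd measurable_fst).inter
      (measurableSet_lt measurable_fst measurable_const))

theorem volume_diagonal_eq_zero : volume {p : ℝ × ℝ | p.1 = p.2} = 0 := by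
  rw [Measure.volume_eq_prod,
    Measure.measure_prod_null (measurableSet_eq_fun measurable_fst measurable_snd)]
  refine .of_forall fun x => ?_
  have : Prod.mk x ⁻¹' {p : ℝ × ℝ | p.1 = p.2} = {x} := by
    ext y; simp [eq_comm]
  simp [this]

/-- The square is the triangle and its mirror image up to the null diagonal. A product of two
antisymmetric modes is symmetric, so orthogonality on the triangle reduces to the square. -/
theorem two_mul_setIntegral_triangleCoord {c : ℝ} {F : ℝ × ℝ → ℝ} (hF : Continuous F)
    (hsymm : ∀ p, F p.swap = F p) :
    2 * ∫ p in triangleCoord c, F p = ∫ p in Ioo 0 c ×ˢ Ioo 0 c, F p := by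
  have hswap : ∫ p in Prod.swap ⁻¹' triangleCoord c, F p = ∫ p in triangleCoord c, F p := by
    have h : MeasurePreserving (Prod.swap : ℝ × ℝ → ℝ × ℝ) volume volume := by
      rw [Measure.volume_eq_prod]
      exact Measure.measurePreserving_swap
    have := h.setIntegral_preimage_emb MeasurableEquiv.prodComm.measurableEmbedding F
      (triangleCoord c)
    simpa only [hsymm] using this
  have hd : Disjoint (triangleCoord c) (Prod.swap ⁻¹' triangleCoord c) :=
    disjoint_left.2 fun p h1 h2 => lt_asymm h1.2.1 h2.2.1
  have hset : (Ioo 0 c ×ˢ Ioo 0 c : Set (ℝ × ℝ)) =ᵐ[volume]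
      (triangleCoord c ∪ Prod.swap ⁻¹' triangleCoord c : Set (ℝ × ℝ)) := by
    have : ∀ᵐ p : ℝ × ℝ, p.1 ≠ p.2 := by
      rw [ae_iff]
      simpa using volume_diagonal_eq_zero
    filter_upwards [this] with p hp
    refine propext ⟨fun h => ?_, fun h => ?_⟩
    · obtain ⟨⟨h1, h2⟩, h3, h4⟩ := h
      rcases lt_or_gt_of_ne hp with hlt | hgt
      · exact Or.inr ⟨h1, hlt, h4⟩
      · exact Or.inl ⟨h3, hgt, h2⟩
    · rcases h with ⟨h1, h2, h3⟩ | ⟨h1, h2, h3⟩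
      · exact ⟨⟨h1.trans h2, h3⟩, h1, h2.trans h3⟩
      · exact ⟨⟨h1, h2.trans h3⟩, h1.trans h2, h3⟩
  have hint : ∀ s ⊆ (Icc (0, 0) (c, c) : Set (ℝ × ℝ)), IntegrableOn F s := fun s hs =>
    (hF.continuousOn.integrableOn_compact isCompact_Icc).mono_set hs
  rw [setIntegral_congr_set hset, setIntegral_union hd
    (measurable_swap (measurableSet_triangleCoord c)) (hint _ ?_) (hint _ ?_), hswap, two_mul]
  · rintro ⟨x, y⟩ ⟨h1, h2, h3⟩
    simp only at h1 h2 h3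
    exact ⟨⟨by dsimp; linarith, by dsimp; linarith⟩, by dsimp; linarith, by dsimp; linarith⟩
  · rintro ⟨x, y⟩ ⟨h1, h2, h3⟩
    simp only [Prod.swap_prod_mk] at h1 h2 h3
    exact ⟨⟨by dsimp; linarith, by dsimp; linarith⟩, by dsimp; linarith, by dsimp; linarith⟩

/-- Fubini replaces reflection for a single triangle mode, which is antisymmetric. -/
theorem setIntegral_triangleCoord {c : ℝ} {F : ℝ × ℝ → ℝ} (hF : Continuous F) :
    ∫ p in triangleCoord c, F p = ∫ x in Ioo 0 c, ∫ y in Ioo 0 x, F (x, y) := by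
  have hint : IntegrableOn F (triangleCoord c) :=
    (hF.continuousOn.integrableOn_compact (isCompact_Icc (a := (0, 0)) (b := (c, c)))).mono_set (by
      rintro ⟨x, y⟩ ⟨h1, h2, h3⟩
      simp only at h1 h2 h3
      exact ⟨⟨by dsimp; linarith, by dsimp; linarith⟩, by dsimp; linarith, by dsimp; linarith⟩)
  rw [← integral_indicator (measurableSet_triangleCoord c), Measure.volume_eq_prod,
    integral_prod _ ((integrable_indicator_iff (measurableSet_triangleCoord c)).2 hint),
    ← integral_indicator measurableSet_Ioo]
  refine integral_congr_ae (.of_forall fun x => ?_)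
  by_cases hx : x ∈ Ioo 0 c
  · simp only [indicator_of_mem hx]
    rw [← integral_indicator measurableSet_Ioo]
    refine integral_congr_ae (.of_forall fun y => ?_)
    by_cases hy : y ∈ Ioo 0 x
    · rw [indicator_of_mem hy]
      exact indicator_of_mem (show (x, y) ∈ triangleCoord c from ⟨hy.1, hy.2, hx.2⟩) F
    · rw [indicator_of_notMem hy]
      exact indicator_of_notMem (fun h => hy ⟨h.1, h.2.1⟩) F
  · simp only [indicator_of_notMem hx]
    refine integral_eq_zero_of_ae (.of_forall fun y => indicator_of_notMem (fun h => hx ?_) _)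
    exact ⟨h.1.trans h.2.1, h.2.2⟩

/-! ### Geometry of rectangles and triangles -/

theorem isCompact_closedRectangle (a b : ℝ) :
    IsCompact {x : Plane | (0 ≤ x 0 ∧ x 0 ≤ a) ∧ 0 ≤ x 1 ∧ x 1 ≤ b} := by
  have h := (EuclideanSpace.equiv (Fin 2) ℝ).toHomeomorph.isCompact_preimage.2
    (isCompact_Icc (a := (0 : Fin 2 → ℝ)) (b := ![a, b]))
  convert h using 1
  ext x
  simp only [mem_preimage, mem_Icc, Pi.le_def, Fin.forall_fin_two]
  exact ⟨fun h => ⟨⟨h.1.1, h.2.1⟩, h.1.2, h.2.2⟩, fun h => ⟨⟨h.1.1, h.2.1⟩, h.1.2, h.2.2⟩⟩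

theorem isCompact_closedTriangle (c : ℝ) :
    IsCompact {x : Plane | 0 ≤ x 1 ∧ x 1 ≤ x 0 ∧ x 0 ≤ c} := by
  refine (isCompact_closedRectangle c c).of_isClosed_subset ?_ fun x hx =>
    ⟨⟨hx.1.trans hx.2.1, hx.2.2⟩, hx.1, hx.2.1.trans hx.2.2⟩
  simp only [ofPred_and]
  exact (isClosed_le (by fun_prop) (by fun_prop)).inter
    ((isClosed_le (by fun_prop) (by fun_prop)).inter (isClosed_le (by fun_prop) (by fun_prop)))

theorem openRectangle_subset (a b : ℝ) :
    openRectangle a b ⊆ {x : Plane | (0 ≤ x 0 ∧ x 0 ≤ a) ∧ 0 ≤ x 1 ∧ x 1 ≤ b} :=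
  fun _ hx => ⟨⟨hx.1.le, hx.2.1.le⟩, hx.2.2.1.le, hx.2.2.2.le⟩

theorem openRightIsoscelesTriangle_subset (c : ℝ) :
    openRightIsoscelesTriangle c ⊆ {x : Plane | 0 ≤ x 1 ∧ x 1 ≤ x 0 ∧ x 0 ≤ c} :=
  fun _ hx => ⟨hx.1.le, hx.2.1.le, hx.2.2.le⟩

theorem isOpen_openRectangle (a b : ℝ) : IsOpen (openRectangle a b) := by
  simp only [openRectangle, ofPred_and]
  exact (isOpen_lt (by fun_prop) (by fun_prop)).inter ((isOpen_lt (by fun_prop) (by fun_prop)).inter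
    ((isOpen_lt (by fun_prop) (by fun_prop)).inter (isOpen_lt (by fun_prop) (by fun_prop))))

theorem isOpen_openRightIsoscelesTriangle (c : ℝ) : IsOpen (openRightIsoscelesTriangle c) := by
  simp only [openRightIsoscelesTriangle, ofPred_and]
  exact (isOpen_lt (by fun_prop) (by fun_prop)).inter
    ((isOpen_lt (by fun_prop) (by fun_prop)).inter (isOpen_lt (by fun_prop) (by fun_prop)))

theorem isBounded_openRectangle (a b : ℝ) : Bornology.IsBounded (openRectangle a b) :=
  (isCompact_closedRectangle a b).isBounded.subset (openRectangle_subset a b)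

theorem isBounded_openRightIsoscelesTriangle (c : ℝ) :
    Bornology.IsBounded (openRightIsoscelesTriangle c) :=
  (isCompact_closedTriangle c).isBounded.subset (openRightIsoscelesTriangle_subset c)

/-- The sine is 1-Lipschitz. This and its two corollaries supply the linear decay of the modes at
the sides. -/
theorem abs_sin_mul_sub_sin_mul_le {k : ℝ} (hk : 0 ≤ k) (s t : ℝ) :
    |sin (k * s) - sin (k * t)| ≤ k * |s - t| := by
  have h := Real.lipschitzWith_sin.dist_le_mul (k * s) (k * t)
  rwa [Real.dist_eq, Real.dist_eq, NNReal.coe_one, one_mul, ← mul_sub, abs_mul,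
    abs_of_nonneg hk] at h

theorem abs_sin_mul_le {k s : ℝ} (hk : 0 ≤ k) (hs : 0 ≤ s) : |sin (k * s)| ≤ k * s := by
  simpa [abs_of_nonneg hs] using abs_sin_mul_sub_sin_mul_le hk s 0

theorem abs_sin_mul_le_sub {a s : ℝ} (ha : 0 < a) (m : ℕ) (hs : s ≤ a) :
    |sin (m * π / a * s)| ≤ m * π / a * (a - s) := by
  have h := abs_sin_mul_sub_sin_mul_le (k := m * π / a) (by positivity) s a
  rw [show m * π / a * a = m * π by field_simp, sin_nat_mul_pi, sub_zero, abs_sub_comm,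
    abs_of_nonneg (sub_nonneg.2 hs)] at h
  exact h

/-! ### Completeness of a family that is stable under two separating multipliers -/

/-- By linearity every hypothesis on the submodule `W` need only be checked on generators. -/
theorem ae_eq_zero_of_forall_integral_mul_eq_zero {P K : Set Plane} (hP : IsOpen P)
    (hK : IsCompact K) (hPK : P ⊆ K) {c₁ c₂ : Plane → ℝ} (hc₁ : Continuous c₁)
    (hc₂ : Continuous c₂) (hsep : ∀ x ∈ K, ∀ y ∈ K, c₁ x = c₁ y → c₂ x = c₂ y → x = y)
    {ι : Type*} {e : ι → Plane → ℝ} (he : ∀ i, Continuous (e i))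
    (h₁ : ∀ i, c₁ * e i ∈ Submodule.span ℝ (range e))
    (h₂ : ∀ i, c₂ * e i ∈ Submodule.span ℝ (range e)) {f : Plane → ℝ}
    (hf : IntegrableOn f P) (hz : ∀ i, ∫ x in P, f x * e i x = 0) {i₀ : ι}
    (hi₀ : ∀ x ∈ P, e i₀ x ≠ 0) : f =ᵐ[volume.restrict P] 0 := by
  have hcont : ∀ w ∈ Submodule.span ℝ (range e), Continuous w := fun w hw => by
    induction hw using Submodule.span_induction with
    | mem w hw => obtain ⟨i, rfl⟩ := hw; exact he i
    | zero => exact continuous_const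
    | add v w _ _ hv hw => exact hv.add hw
    | smul r w _ hw => exact hw.const_smul r
  have hmul : ∀ {c : Plane → ℝ}, (∀ i, c * e i ∈ Submodule.span ℝ (range e)) →
      ∀ w ∈ Submodule.span ℝ (range e), c * w ∈ Submodule.span ℝ (range e) := fun {c} h w hw => by
    induction hw using Submodule.span_induction with
    | mem w hw => obtain ⟨i, rfl⟩ := hw; exact h i
    | zero => rw [mul_zero]; exact Submodule.zero_mem _
    | add v w _ _ hv hw => rw [mul_add]; exact Submodule.add_mem _ hv hw
    | smul r w _ hw => rw [mul_smul_comm]; exact Submodule.smul_mem _ r hw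
  have hint : ∀ {g : Plane → ℝ}, Continuous g → IntegrableOn (fun x => f x * g x) P := by
    intro g hg
    obtain ⟨B, hB⟩ := hK.exists_bound_of_continuousOn hg.continuousOn
    refine Integrable.mul_bdd (c := B) hf hg.aestronglyMeasurable ?_
    filter_upwards [ae_restrict_mem hP.measurableSet] with x hx using hB x (hPK hx)
  refine ae_eq_zero_of_integral_mul_eq_zero hP hK hPK hc₁ hc₂ hsep (Submodule.span ℝ (range e))
    hcont (hmul h₁) (hmul h₂) hf (fun w hw => ?_) (Submodule.subset_span (mem_range_self i₀)) hi₀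
  induction hw using Submodule.span_induction with
  | mem w hw => obtain ⟨i, rfl⟩ := hw; exact hz i
  | zero => simp
  | add v w hv hw ihv ihw =>
    simp only [Pi.add_apply, mul_add]
    rw [integral_add (hint (hcont v hv)) (hint (hcont w hw)), ihv, ihw, add_zero]
  | smul r w _ ih =>
    simp only [Pi.smul_apply, smul_eq_mul, mul_left_comm _ r]
    rw [integral_const_mul, ih, mul_zero]

theorem eq_of_cos_pi_div_eq {a s t : ℝ} (ha : 0 < a) (hs : s ∈ Icc 0 a) (ht : t ∈ Icc 0 a)
    (h : cos (π / a * s) = cos (π / a * t)) : s = t := by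
  have hmem : ∀ {r}, r ∈ Icc 0 a → π / a * r ∈ Icc 0 π := fun {r} hr => by
    refine ⟨mul_nonneg (by positivity) hr.1, ?_⟩
    rw [div_mul_eq_mul_div, div_le_iff₀ ha]
    exact mul_le_mul_of_nonneg_left hr.2 pi_pos.le
  exact mul_left_cancel₀ (by positivity) (injOn_cos (hmem hs) (hmem ht) h)

theorem sin_pi_div_pos {a s : ℝ} (ha : 0 < a) (h0 : 0 < s) (h1 : s < a) : 0 < sin (π / a * s) := by
  refine sin_pos_of_pos_of_lt_pi (by positivity) ?_
  rw [div_mul_eq_mul_div, div_lt_iff₀ ha]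
  exact mul_lt_mul_of_pos_left h1 pi_pos

/-! ### The eigenfunctions of a rectangle -/

/-- The normalized Dirichlet eigenfunctions of the rectangle `(0, a) × (0, b)`. -/
def rectMode (a b : ℝ) (p : RectIndex) : Plane → ℝ :=
  standingWave (2 / √(a * b)) 0 (p.1.1 * π / a) (p.1.2 * π / b)

theorem rectMode_apply (a b : ℝ) (p : RectIndex) (x : Plane) :
    rectMode a b p x =
      2 / √(a * b) * (sin (p.1.1 * π / a * x 0) * sin (p.1.2 * π / b * x 1)) := by
  simp [rectMode, standingWave]

theorem integral_rectMode_mul_rectMode {a b : ℝ} (ha : 0 < a) (hb : 0 < b) (p q : RectIndex) :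
    ∫ x in openRectangle a b, rectMode a b p x * rectMode a b q x =
      (2 / √(a * b)) ^ 2 * ((if p.1.1 = q.1.1 then a / 2 else 0) *
        (if p.1.2 = q.1.2 then b / 2 else 0)) := by
  rw [← integral_Ioo_sin_mul_sin ha p.2.1, ← integral_Ioo_sin_mul_sin hb p.2.2,
    ← setIntegral_openRectangle_mul, ← integral_const_mul]
  refine integral_congr_ae (.of_forall fun x => ?_)
  simp only [rectMode_apply]
  ring

/-- With indices in ℤ the sine products are stable under the cosine multipliers, by 2 cos A sin(mA)
= sin((m+1)A) + sin((m-1)A). Zero and negative indices bring no new condition, since the sine is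
odd. Cosine is injective on [0, π], so the multipliers separate points, and the mode (1, 1) is
positive. -/
theorem complete_rectMode {a b : ℝ} (ha : 0 < a) (hb : 0 < b) {f : Plane → ℝ}
    (hf : IntegrableOn f (openRectangle a b))
    (hz : ∀ p, ∫ x in openRectangle a b, f x * rectMode a b p x = 0) :
    f =ᵐ[volume.restrict (openRectangle a b)] 0 := by
  let e : ℤ × ℤ → Plane → ℝ := fun p x => sin (p.1 * (π / a * x 0)) * sin (p.2 * (π / b * x 1))
  have hα : 2 / √(a * b) ≠ 0 := by positivity
  have hnat : ∀ m n : ℕ, ∫ x in openRectangle a b, f x * e (m, n) x = 0 := by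
    intro m n
    rcases Nat.eq_zero_or_pos m with rfl | hm
    · simp [e]
    rcases Nat.eq_zero_or_pos n with rfl | hn
    · simp [e]
    have h := hz ⟨(m, n), hm, hn⟩
    have he : ∀ x, f x * rectMode a b ⟨(m, n), hm, hn⟩ x =
        2 / √(a * b) * (f x * e (m, n) x) := fun x => by
      simp only [rectMode_apply, e, Int.cast_natCast, ← mul_assoc, mul_div_assoc]
      ring
    simp only [he] at h
    rw [integral_const_mul] at h
    exact (mul_eq_zero.1 h).resolve_left hα
  refine ae_eq_zero_of_forall_integral_mul_eq_zero (isOpen_openRectangle a b)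
    (isCompact_closedRectangle a b) (openRectangle_subset a b)
    (c₁ := fun x => cos (π / a * x 0)) (c₂ := fun x => cos (π / b * x 1)) (by fun_prop)
    (by fun_prop) (fun x hx y hy h1 h2 => ?_) (e := e) (fun p => by simp only [e]; fun_prop)
    (fun p => ?_) (fun p => ?_) hf (fun p => ?_) (i₀ := (1, 1)) (fun x hx => ?_)
  · ext i
    fin_cases i
    · exact eq_of_cos_pi_div_eq ha hx.1 hy.1 h1
    · exact eq_of_cos_pi_div_eq hb hx.2 hy.2 h2
  · have h : (fun x : Plane => cos (π / a * x 0)) * e p =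
        (1 / 2 : ℝ) • (e (p.1 + 1, p.2) + e (p.1 - 1, p.2)) := by
      ext x
      simp only [e, Pi.mul_apply, Pi.smul_apply, Pi.add_apply, smul_eq_mul, Int.cast_add,
        Int.cast_sub, Int.cast_one, add_mul, sub_mul, one_mul, sin_add, sin_sub]
      ring
    rw [h]
    exact Submodule.smul_mem _ _ (Submodule.add_mem _ (Submodule.subset_span (mem_range_self _))
      (Submodule.subset_span (mem_range_self _)))
  · have h : (fun x : Plane => cos (π / b * x 1)) * e p =
        (1 / 2 : ℝ) • (e (p.1, p.2 + 1) + e (p.1, p.2 - 1)) := by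
      ext x
      simp only [e, Pi.mul_apply, Pi.smul_apply, Pi.add_apply, smul_eq_mul, Int.cast_add,
        Int.cast_sub, Int.cast_one, add_mul, sub_mul, one_mul, sin_add, sin_sub]
      ring
    rw [h]
    exact Submodule.smul_mem _ _ (Submodule.add_mem _ (Submodule.subset_span (mem_range_self _))
      (Submodule.subset_span (mem_range_self _)))
  · have key := hnat p.1.natAbs p.2.natAbs
    obtain ⟨m, n⟩ := p
    rcases Int.natAbs_eq m with hm | hm <;> rcases Int.natAbs_eq n with hn | hn <;>
      rw [hm, hn] <;>
      simpa only [e, Int.cast_neg, neg_mul, sin_neg, mul_neg, neg_neg, integral_neg, neg_eq_zero,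
        Int.natAbs_neg, Int.natAbs_natCast] using key
  · have h1 := sin_pi_div_pos ha hx.1 hx.2.1
    have h2 := sin_pi_div_pos hb hx.2.2.1 hx.2.2.2
    simp only [e, Int.cast_one, one_mul]
    positivity

theorem isEigenfamily_rectMode {a b : ℝ} (ha : 0 < a) (hb : 0 < b) :
    IsEigenfamily (openRectangle a b) (rectEigenvalue a b) (rectMode a b) where
  isOpen := isOpen_openRectangle a b
  isBounded := isBounded_openRectangle a b
  nonneg p := by unfold rectEigenvalue; positivity
  summable s hs := summable_rectEigenvalue ha hb hs
  contDiff p := standingWave_contDiff _ _ _ _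
  approx p := by
    have hα : 0 ≤ 2 / √(a * b) := by positivity
    have hk : 0 ≤ p.1.1 * π / a := by positivity
    have hl : 0 ≤ p.1.2 * π / b := by positivity
    refine exists_testFunction_approx_of_polygon
      (f := ![EuclideanSpace.proj 0, -EuclideanSpace.proj 0, EuclideanSpace.proj 1,
        -EuclideanSpace.proj 1]) (γ := ![0, a, 0, b])
      (C := 2 / √(a * b) * (p.1.1 * π / a + p.1.2 * π / b)) ?_ (isBounded_openRectangle a b)
      (standingWave_contDiff _ _ _ _) fun x hx i => ?_
    · ext x
      simp [openRectangle, Fin.forall_fin_succ, neg_add_eq_sub]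
    · obtain ⟨h0, h1, h2, h3⟩ := hx
      have key : ∀ d, 0 ≤ d → (|sin (p.1.1 * π / a * x 0)| ≤ p.1.1 * π / a * d ∨
          |sin (p.1.2 * π / b * x 1)| ≤ p.1.2 * π / b * d) →
          |rectMode a b p x| ≤ 2 / √(a * b) * (p.1.1 * π / a + p.1.2 * π / b) * d := by
        intro d hd h
        rw [rectMode_apply, abs_mul, abs_of_nonneg hα, mul_assoc, abs_mul]
        refine mul_le_mul_of_nonneg_left ?_ hα
        have e1 := abs_sin_le_one (p.1.1 * π / a * x 0)
        have e2 := abs_sin_le_one (p.1.2 * π / b * x 1)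
        have e3 := mul_nonneg hk hd
        have e4 := mul_nonneg hl hd
        rcases h with h | h
        · refine (mul_le_of_le_one_right (abs_nonneg _) e2).trans ?_
          linarith
        · refine (mul_le_of_le_one_left (abs_nonneg _) e1).trans ?_
          linarith
      fin_cases i
      · simpa using key (x 0) h0.le (Or.inl (abs_sin_mul_le hk h0.le))
      · simpa [neg_add_eq_sub] using key (a - x 0) (by linarith)
          (Or.inl (abs_sin_mul_le_sub ha _ h1.le))
      · simpa using key (x 1) h2.le (Or.inr (abs_sin_mul_le hl h2.le))
      · simpa [neg_add_eq_sub] using key (b - x 1) (by linarith)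
          (Or.inr (abs_sin_mul_le_sub hb _ h3.le))
  weak p ψ hψ := setIntegral_inner_gradient_standingWave _ _ _ _ hψ
  normalized p := by
    rw [integral_rectMode_mul_rectMode ha hb, if_pos rfl, if_pos rfl, div_pow,
      Real.sq_sqrt (by positivity)]
    field_simp
  orthogonal p q hpq := by
    rw [integral_rectMode_mul_rectMode ha hb]
    by_cases h1 : p.1.1 = q.1.1
    · rw [if_neg fun h2 => hpq (Subtype.ext (Prod.ext h1 h2))]
      simp
    · simp [h1]
  complete f hf hz := by
    have := isFiniteMeasure_restrict_of_isBounded (isBounded_openRectangle a b)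
    exact complete_rectMode ha hb (hf.integrable one_le_two) hz

/-! ### The eigenfunctions of a right isosceles triangle -/

/-- The normalized Dirichlet eigenfunctions of the right isosceles triangle with legs `c`. -/
def triMode (c : ℝ) (p : TriIndex) : Plane → ℝ :=
  standingWave (2 / c) (-(2 / c)) (p.1.1 * π / c) (p.1.2 * π / c)

theorem triMode_apply (c : ℝ) (p : TriIndex) (x : Plane) :
    triMode c p x = 2 / c * (sin (p.1.1 * π / c * x 0) * sin (p.1.2 * π / c * x 1) -
      sin (p.1.2 * π / c * x 0) * sin (p.1.1 * π / c * x 1)) := by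
  simp only [triMode, standingWave]
  ring

theorem integral_square_sin_mul_sin {c : ℝ} (hc : 0 < c) {m n m' n' : ℕ} (hm : 0 < m)
    (hn : 0 < n) :
    ∫ z in Ioo 0 c ×ˢ Ioo 0 c, sin (m * π / c * z.1) * sin (m' * π / c * z.1) *
        (sin (n * π / c * z.2) * sin (n' * π / c * z.2)) =
      (if m = m' then c / 2 else 0) * (if n = n' then c / 2 else 0) := by
  rw [← integral_Ioo_sin_mul_sin hc hm, ← integral_Ioo_sin_mul_sin hc hn,
    Measure.volume_eq_prod, ← setIntegral_prod_mul]

/-- Doubling to the square gives four products of one-dimensional integrals, two direct and two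
crossed. -/
theorem integral_triMode_mul_triMode {c : ℝ} (hc : 0 < c) (p q : TriIndex) :
    ∫ x in openRightIsoscelesTriangle c, triMode c p x * triMode c q x =
      if p = q then 1 else 0 := by
  obtain ⟨⟨m, n⟩, hn, hmn⟩ := p
  obtain ⟨⟨m', n'⟩, hn', hmn'⟩ := q
  simp only at hn hmn hn' hmn'
  let T : ℕ → ℕ → ℕ → ℕ → ℝ × ℝ → ℝ := fun i j k l z =>
    sin (i * π / c * z.1) * sin (j * π / c * z.1) * (sin (k * π / c * z.2) * sin (l * π / c * z.2))
  let F : ℝ × ℝ → ℝ := T m m' n n' - T m n' n m' - T n m' m n' + T n n' m m'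
  have hTc : ∀ i j k l, Continuous (T i j k l) := fun i j k l => by
    simp only [T]
    fun_prop
  have hFc : Continuous F :=
    (((hTc _ _ _ _).sub (hTc _ _ _ _)).sub (hTc _ _ _ _)).add (hTc _ _ _ _)
  have hTi : ∀ i j k l, IntegrableOn (T i j k l) (Ioo 0 c ×ˢ Ioo 0 c) := fun i j k l =>
    ((hTc i j k l).continuousOn.integrableOn_compact
      (isCompact_Icc.prod isCompact_Icc)).mono_set
      (prod_mono Ioo_subset_Icc_self Ioo_subset_Icc_self)
  have hm : 0 < m := hn.trans hmn
  have h1 : ∫ x in openRightIsoscelesTriangle c,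
      triMode c ⟨(m, n), hn, hmn⟩ x * triMode c ⟨(m', n'), hn', hmn'⟩ x =
      (2 / c) ^ 2 * ∫ z in triangleCoord c, F z := by
    rw [openRightIsoscelesTriangle_eq_preimage, ← setIntegral_planeCoord, ← integral_const_mul]
    refine integral_congr_ae (.of_forall fun x => ?_)
    simp only [triMode_apply, F, T, Pi.add_apply, Pi.sub_apply]
    ring
  have h2 : 2 * ∫ z in triangleCoord c, F z = ∫ z in Ioo 0 c ×ˢ Ioo 0 c, F z :=
    two_mul_setIntegral_triangleCoord hFc fun z => by
      simp only [F, T, Pi.add_apply, Pi.sub_apply, Prod.fst_swap, Prod.snd_swap]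
      ring
  have h3 : ∫ z in Ioo 0 c ×ˢ Ioo 0 c, F z =
      2 * ((if m = m' then c / 2 else 0) * (if n = n' then c / 2 else 0)) := by
    simp only [F]
    rw [integral_add' (((hTi _ _ _ _).sub (hTi _ _ _ _)).sub (hTi _ _ _ _)) (hTi _ _ _ _),
      integral_sub' ((hTi _ _ _ _).sub (hTi _ _ _ _)) (hTi _ _ _ _),
      integral_sub' (hTi _ _ _ _) (hTi _ _ _ _)]
    simp only [T]
    rw [integral_square_sin_mul_sin hc hm hn, integral_square_sin_mul_sin hc hm hn,
      integral_square_sin_mul_sin hc hn hm, integral_square_sin_mul_sin hc hn hm]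
    -- The crossed terms would need m = n' and n = m', against n < m and n' < m'.
    have hz : (if m = n' then c / 2 else 0) * (if n = m' then c / 2 else 0) = 0 := by
      by_cases h : m = n'
      · rw [if_neg (show ¬ n = m' by omega), mul_zero]
      · rw [if_neg h, zero_mul]
    linear_combination (-2) * hz
  have h4 : ∫ z in triangleCoord c, F z =
      (if m = m' then c / 2 else 0) * (if n = n' then c / 2 else 0) := by linarith
  rw [h1, h4]
  simp only [Subtype.mk.injEq, Prod.mk.injEq]
  by_cases hmm : m = m' <;> by_cases hnn : n = n' <;> simp only [hmm, hnn, if_true, if_false,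
    and_true, and_false, and_self, mul_zero, zero_mul]
  field_simp

/-- Only symmetric multipliers preserve antisymmetry; the sum and the product of the two cosines are
the elementary symmetric ones. -/
theorem cos_mul_standingWave_diff (A B m n : ℝ) :
    (cos A + cos B) * (sin (m * A) * sin (n * B) - sin (n * A) * sin (m * B)) =
      1 / 2 * ((sin ((m + 1) * A) * sin (n * B) - sin (n * A) * sin ((m + 1) * B)) +
        (sin ((m - 1) * A) * sin (n * B) - sin (n * A) * sin ((m - 1) * B)) +
        (sin (m * A) * sin ((n + 1) * B) - sin ((n + 1) * A) * sin (m * B)) +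
        (sin (m * A) * sin ((n - 1) * B) - sin ((n - 1) * A) * sin (m * B))) := by
  simp only [add_mul _ (1 : ℝ), sub_mul _ (1 : ℝ), one_mul, sin_add, sin_sub]
  ring

theorem cos_mul_cos_mul_standingWave_diff (A B m n : ℝ) :
    cos A * cos B * (sin (m * A) * sin (n * B) - sin (n * A) * sin (m * B)) =
      1 / 4 * ((sin ((m + 1) * A) * sin ((n + 1) * B) - sin ((n + 1) * A) * sin ((m + 1) * B)) +
        (sin ((m + 1) * A) * sin ((n - 1) * B) - sin ((n - 1) * A) * sin ((m + 1) * B)) +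
        (sin ((m - 1) * A) * sin ((n + 1) * B) - sin ((n + 1) * A) * sin ((m - 1) * B)) +
        (sin ((m - 1) * A) * sin ((n - 1) * B) - sin ((n - 1) * A) * sin ((m - 1) * B))) := by
  simp only [add_mul _ (1 : ℝ), sub_mul _ (1 : ℝ), one_mul, sin_add, sin_sub]
  ring

/-- Sum and product determine the gap, by (v - u)² = (u + v)² - 4uv. -/
theorem eq_of_add_eq_of_mul_eq {u v u' v' : ℝ} (h : u ≤ v) (h' : u' ≤ v') (hs : u + v = u' + v')
    (hp : u * v = u' * v') : u = u' ∧ v = v' := by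
  have hd : v - u = v' - u' := by
    refine (sq_eq_sq₀ (sub_nonneg.2 h) (sub_nonneg.2 h')).1 ?_
    linear_combination (u + v + u' + v') * hs - 4 * hp
  constructor <;> linarith

/-- As for the rectangle, with the symmetric multipliers. They recover the two cosines only up to
order, but on the triangle x₁ ≤ x₀ fixes the order because cosine decreases. -/
theorem complete_triMode {c : ℝ} (hc : 0 < c) {f : Plane → ℝ}
    (hf : IntegrableOn f (openRightIsoscelesTriangle c))
    (hz : ∀ p, ∫ x in openRightIsoscelesTriangle c, f x * triMode c p x = 0) :
    f =ᵐ[volume.restrict (openRightIsoscelesTriangle c)] 0 := by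
  let e : ℤ × ℤ → Plane → ℝ := fun p x =>
    sin (p.1 * (π / c * x 0)) * sin (p.2 * (π / c * x 1)) -
      sin (p.2 * (π / c * x 0)) * sin (p.1 * (π / c * x 1))
  have hα : 2 / c ≠ 0 := by positivity
  have hlt : ∀ m n : ℕ, n < m → ∫ x in openRightIsoscelesTriangle c, f x * e (m, n) x = 0 := by
    intro m n hmn
    rcases Nat.eq_zero_or_pos n with rfl | hn
    · simp [e]
    have h := hz ⟨(m, n), hn, hmn⟩
    have he : ∀ x, f x * triMode c ⟨(m, n), hn, hmn⟩ x = 2 / c * (f x * e (m, n) x) := fun x => by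
      simp only [triMode_apply, e, Int.cast_natCast, ← mul_assoc, mul_div_assoc]
      ring
    simp only [he] at h
    rw [integral_const_mul] at h
    exact (mul_eq_zero.1 h).resolve_left hα
  have hanti : ∀ m n x, e (n, m) x = -e (m, n) x := fun m n x => by
    simp only [e]
    ring
  have hnat : ∀ m n : ℕ, ∫ x in openRightIsoscelesTriangle c, f x * e (m, n) x = 0 := by
    intro m n
    rcases lt_trichotomy n m with h | rfl | h
    · exact hlt m n h
    · have : ∀ x, e (n, n) x = 0 := fun x => by simp [e]
      simp [this]
    · simp only [hanti (n : ℤ) m, mul_neg, integral_neg, hlt n m h, neg_zero]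
  refine ae_eq_zero_of_forall_integral_mul_eq_zero (isOpen_openRightIsoscelesTriangle c)
    (isCompact_closedTriangle c) (openRightIsoscelesTriangle_subset c)
    (c₁ := fun x => cos (π / c * x 0) + cos (π / c * x 1))
    (c₂ := fun x => cos (π / c * x 0) * cos (π / c * x 1)) (by fun_prop) (by fun_prop)
    (fun x hx y hy h1 h2 => ?_) (e := e) (fun p => by simp only [e]; fun_prop)
    (fun p => ?_) (fun p => ?_) hf (fun p => ?_) (i₀ := (2, 1)) (fun x hx => ?_)
  · have hle : ∀ z : Plane, z ∈ {x : Plane | 0 ≤ x 1 ∧ x 1 ≤ x 0 ∧ x 0 ≤ c} →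
        cos (π / c * z 0) ≤ cos (π / c * z 1) := fun z hz => by
      refine cos_le_cos_of_nonneg_of_le_pi (mul_nonneg (by positivity) hz.1) ?_
        (mul_le_mul_of_nonneg_left hz.2.1 (by positivity))
      rw [div_mul_eq_mul_div, div_le_iff₀ hc]
      exact mul_le_mul_of_nonneg_left hz.2.2 pi_pos.le
    obtain ⟨e0, e1⟩ := eq_of_add_eq_of_mul_eq (hle x hx) (hle y hy) h1 h2
    ext i
    fin_cases i
    · exact eq_of_cos_pi_div_eq hc ⟨hx.1.trans hx.2.1, hx.2.2⟩ ⟨hy.1.trans hy.2.1, hy.2.2⟩ e0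
    · exact eq_of_cos_pi_div_eq hc ⟨hx.1, hx.2.1.trans hx.2.2⟩ ⟨hy.1, hy.2.1.trans hy.2.2⟩ e1
  · have h : (fun x : Plane => cos (π / c * x 0) + cos (π / c * x 1)) * e p =
        (1 / 2 : ℝ) • (e (p.1 + 1, p.2) + e (p.1 - 1, p.2) + e (p.1, p.2 + 1) +
          e (p.1, p.2 - 1)) := by
      ext x
      simpa [e] using cos_mul_standingWave_diff (π / c * x 0) (π / c * x 1) p.1 p.2
    rw [h]
    exact Submodule.smul_mem _ _ (Submodule.add_mem _ (Submodule.add_mem _ (Submodule.add_mem _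
      (Submodule.subset_span (mem_range_self _)) (Submodule.subset_span (mem_range_self _)))
      (Submodule.subset_span (mem_range_self _))) (Submodule.subset_span (mem_range_self _)))
  · have h : (fun x : Plane => cos (π / c * x 0) * cos (π / c * x 1)) * e p =
        (1 / 4 : ℝ) • (e (p.1 + 1, p.2 + 1) + e (p.1 + 1, p.2 - 1) + e (p.1 - 1, p.2 + 1) +
          e (p.1 - 1, p.2 - 1)) := by
      ext x
      simpa [e] using cos_mul_cos_mul_standingWave_diff (π / c * x 0) (π / c * x 1) p.1 p.2
    rw [h]
    exact Submodule.smul_mem _ _ (Submodule.add_mem _ (Submodule.add_mem _ (Submodule.add_mem _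
      (Submodule.subset_span (mem_range_self _)) (Submodule.subset_span (mem_range_self _)))
      (Submodule.subset_span (mem_range_self _))) (Submodule.subset_span (mem_range_self _)))
  · have key := hnat p.1.natAbs p.2.natAbs
    obtain ⟨m, n⟩ := p
    have hneg₁ : ∀ (m n : ℤ) (x : Plane), e (-m, n) x = -e (m, n) x := fun m n x => by
      simp only [e, Int.cast_neg, neg_mul, sin_neg]
      ring
    have hneg₂ : ∀ (m n : ℤ) (x : Plane), e (m, -n) x = -e (m, n) x := fun m n x => by
      simp only [e, Int.cast_neg, neg_mul, sin_neg]
      ring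
    rcases Int.natAbs_eq m with hm | hm <;> rcases Int.natAbs_eq n with hn | hn <;>
      rw [hm, hn] <;>
      simpa only [hneg₁, hneg₂, mul_neg, neg_neg, integral_neg, neg_eq_zero,
        Int.natAbs_neg, Int.natAbs_natCast] using key
  · obtain ⟨h0, h1, h2⟩ := hx
    have s0 := sin_pi_div_pos hc (h0.trans h1) h2
    have s1 := sin_pi_div_pos hc h0 (h1.trans h2)
    have hcos : cos (π / c * x 0) < cos (π / c * x 1) := by
      refine cos_lt_cos_of_nonneg_of_le_pi (by positivity) ?_
        (mul_lt_mul_of_pos_left h1 (by positivity))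
      rw [div_mul_eq_mul_div, div_le_iff₀ hc]
      exact mul_le_mul_of_nonneg_left h2.le pi_pos.le
    -- The factorization shows that the lowest mode has no zero inside the triangle.
    have he : e (2, 1) x = -(2 * (sin (π / c * x 0) * sin (π / c * x 1) *
        (cos (π / c * x 1) - cos (π / c * x 0)))) := by
      simp only [e, Int.cast_one, one_mul, Int.cast_ofNat, sin_two_mul]
      ring
    rw [he]
    have := mul_pos (mul_pos s0 s1) (sub_pos.2 hcos)
    exact (neg_neg_of_pos (by positivity)).ne

theorem isEigenfamily_triMode {c : ℝ} (hc : 0 < c) :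
    IsEigenfamily (openRightIsoscelesTriangle c) (triEigenvalue c) (triMode c) where
  isOpen := isOpen_openRightIsoscelesTriangle c
  isBounded := isBounded_openRightIsoscelesTriangle c
  nonneg p := by unfold triEigenvalue; positivity
  summable s hs := summable_triEigenvalue hc hs
  contDiff p := standingWave_contDiff _ _ _ _
  approx p := by
    have hα : 0 ≤ 2 / c := by positivity
    have hk : 0 ≤ p.1.1 * π / c := by positivity
    have hl : 0 ≤ p.1.2 * π / c := by positivity
    refine exists_testFunction_approx_of_polygon
      (f := ![EuclideanSpace.proj 1, EuclideanSpace.proj 0 - EuclideanSpace.proj 1,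
        -EuclideanSpace.proj 0]) (γ := ![0, 0, c])
      (C := 2 / c * (p.1.1 * π / c + p.1.2 * π / c)) ?_ (isBounded_openRightIsoscelesTriangle c)
      (standingWave_contDiff _ _ _ _) fun x hx i => ?_
    · ext x
      simp [openRightIsoscelesTriangle, Fin.forall_fin_succ, neg_add_eq_sub]
    · obtain ⟨h0, h1, h2⟩ := hx
      have key : ∀ {r s t u d : ℝ}, |r| ≤ 1 → |t| ≤ 1 → |s| ≤ p.1.2 * π / c * d →
          |u| ≤ p.1.1 * π / c * d → triMode c p x = 2 / c * (r * s - t * u) →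
          |triMode c p x| ≤ 2 / c * (p.1.1 * π / c + p.1.2 * π / c) * d := by
        intro r s t u d hr ht hs hu h
        rw [h, abs_mul, abs_of_nonneg hα, mul_assoc]
        refine mul_le_mul_of_nonneg_left ?_ hα
        have e1 := (abs_mul r s).le.trans (mul_le_of_le_one_left (abs_nonneg s) hr)
        have e2 := (abs_mul t u).le.trans (mul_le_of_le_one_left (abs_nonneg u) ht)
        linarith [abs_sub (r * s) (t * u)]
      fin_cases i
      · simpa using key (d := x 1) (abs_sin_le_one _) (abs_sin_le_one _) (abs_sin_mul_le hl h0.le)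
          (abs_sin_mul_le hk h0.le) (triMode_apply c p x)
      -- At the hypotenuse no single sine is small. Adding and subtracting sin(k x₀) sin(l x₀)
      -- writes the mode through differences of sines at x₁ and x₀.
      · have e1 := abs_sin_mul_sub_sin_mul_le hl (x 1) (x 0)
        have e2 := abs_sin_mul_sub_sin_mul_le hk (x 1) (x 0)
        rw [abs_sub_comm (x 1), abs_of_pos (sub_pos.2 h1)] at e1 e2
        simpa using key (d := x 0 - x 1) (abs_sin_le_one (p.1.1 * π / c * x 0))
          (abs_sin_le_one (p.1.2 * π / c * x 0)) e1 e2 (by rw [triMode_apply]; ring)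
      · have e1 := abs_sin_mul_le_sub hc p.1.2 h2.le
        have e2 := abs_sin_mul_le_sub hc p.1.1 h2.le
        have e3 := (abs_neg _).trans_le (abs_sin_le_one (p.1.1 * π / c * x 1))
        have e4 := (abs_neg _).trans_le (abs_sin_le_one (p.1.2 * π / c * x 1))
        simpa [neg_add_eq_sub] using key (d := c - x 0) e3 e4 e1 e2
          (by rw [triMode_apply]; ring)
  weak p ψ hψ := setIntegral_inner_gradient_standingWave _ _ _ _ hψ
  normalized p := by rw [integral_triMode_mul_triMode hc, if_pos rfl]
  orthogonal p q hpq := by rw [integral_triMode_mul_triMode hc, if_neg hpq]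
  complete f hf hz := by
    have := isFiniteMeasure_restrict_of_isBounded (isBounded_openRightIsoscelesTriangle c)
    exact complete_triMode hc (hf.integrable one_le_two) hz

/-! ### Integrals of the ground states -/

theorem setIntegral_rectMode_one_one (h : 0 < 1 ∧ 0 < 1) :
    (∫ x in openRectangle 1 2, rectMode 1 2 ⟨(1, 1), h⟩ x) ^ 2 = 1152 / (9 * π ^ 4) := by
  have h1 : ∫ x in openRectangle 1 2, rectMode 1 2 ⟨(1, 1), h⟩ x =
      2 / √(1 * 2) * ((2 * 1 / π) * (2 * 2 / π)) := by
    rw [← integral_Ioo_sin_pi_div one_pos, ← integral_Ioo_sin_pi_div two_pos,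
      ← setIntegral_openRectangle_mul, ← integral_const_mul]
    refine integral_congr_ae (.of_forall fun x => ?_)
    simp [rectMode_apply]
  rw [h1, mul_pow, div_pow, Real.sq_sqrt (by norm_num)]
  field_simp
  norm_num

/-- Both integrations have elementary antiderivatives, polynomial in sine and cosine of the
integration variable. For legs 2 the normalizing factor 2/c is 1, so this is the integral of the
normalized ground state; its sign disappears on squaring. -/
theorem integral_triangleCoord_groundState :
    ∫ p in triangleCoord 2, (sin (2 * (π / 2 * p.1)) * sin (π / 2 * p.2) -
      sin (π / 2 * p.1) * sin (2 * (π / 2 * p.2))) = -(32 / (3 * π ^ 2)) := by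
  rw [setIntegral_triangleCoord (by fun_prop)]
  have hinner : ∀ x ∈ Ioo (0 : ℝ) 2, ∫ y in Ioo 0 x, (sin (2 * (π / 2 * x)) * sin (π / 2 * y) -
      sin (π / 2 * x) * sin (2 * (π / 2 * y))) =
      2 / π * (2 * sin (π / 2 * x) * cos (π / 2 * x) - sin (π / 2 * x) -
        sin (π / 2 * x) * cos (π / 2 * x) ^ 2) := by
    intro x hx
    have hder : ∀ y ∈ uIcc 0 x, HasDerivAt
        (fun y => sin (2 * (π / 2 * x)) * (-(2 / π) * cos (π / 2 * y)) -
          sin (π / 2 * x) * (2 / π * sin (π / 2 * y) ^ 2))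
        (sin (2 * (π / 2 * x)) * sin (π / 2 * y) - sin (π / 2 * x) * sin (2 * (π / 2 * y))) y := by
      intro y _
      have hl : HasDerivAt (fun y => π / 2 * y) (π / 2) y := by
        simpa using (hasDerivAt_id y).const_mul (π / 2)
      refine (((hl.cos.const_mul _).const_mul _).sub (((hl.sin.pow 2).const_mul _).const_mul
        _)).congr_deriv ?_
      rw [sin_two_mul (π / 2 * y)]
      field_simp
      ring
    rw [← integral_Ioc_eq_integral_Ioo, ← intervalIntegral.integral_of_le hx.1.le,
      intervalIntegral.integral_eq_sub_of_hasDerivAt hder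
        (Continuous.intervalIntegrable (by fun_prop) _ _)]
    simp only [mul_zero, cos_zero, sin_zero, sin_two_mul]
    have := sin_sq (π / 2 * x)
    rw [this]
    ring
  rw [setIntegral_congr_fun measurableSet_Ioo hinner]
  have hder : ∀ x ∈ uIcc (0 : ℝ) 2, HasDerivAt
      (fun x => (2 / π) ^ 2 * (-cos (π / 2 * x) ^ 2 + cos (π / 2 * x) + cos (π / 2 * x) ^ 3 / 3))
      (2 / π * (2 * sin (π / 2 * x) * cos (π / 2 * x) - sin (π / 2 * x) -
        sin (π / 2 * x) * cos (π / 2 * x) ^ 2)) x := by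
    intro x _
    have hl : HasDerivAt (fun y => π / 2 * y) (π / 2) x := by
      simpa using (hasDerivAt_id x).const_mul (π / 2)
    refine ((((hl.cos.pow 2).neg.add hl.cos).add ((hl.cos.pow 3).div_const 3)).const_mul
      _).congr_deriv ?_
    field_simp
    ring
  rw [← integral_Ioc_eq_integral_Ioo, ← intervalIntegral.integral_of_le zero_le_two,
    intervalIntegral.integral_eq_sub_of_hasDerivAt hder
      (Continuous.intervalIntegrable (by fun_prop) _ _)]
  rw [show π / 2 * 2 = π by ring, mul_zero, cos_pi, cos_zero]
  field_simp
  norm_num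

theorem setIntegral_triMode_two_one (h : 0 < 1 ∧ 1 < 2) :
    (∫ x in openRightIsoscelesTriangle 2, triMode 2 ⟨(2, 1), h⟩ x) ^ 2 = 1024 / (9 * π ^ 4) := by
  have h1 : ∫ x in openRightIsoscelesTriangle 2, triMode 2 ⟨(2, 1), h⟩ x = -(32 / (3 * π ^ 2)) := by
    rw [← integral_triangleCoord_groundState, openRightIsoscelesTriangle_eq_preimage,
      ← setIntegral_planeCoord]
    refine integral_congr_ae (.of_forall fun x => ?_)
    simp only [triMode_apply]
    push_cast
    rw [div_self two_ne_zero, one_mul, one_mul]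
    ring_nf
  rw [h1]
  field_simp
  norm_num

/-! ### The two bands -/

theorem exists_eigenbasis_of_isTwoPieceBand {P₁ P₂ Ω : Set Plane} {ι₁ ι₂ : Type*} {ev₁ : ι₁ → ℝ}
    {ev₂ : ι₂ → ℝ} {w₁ : ι₁ → Plane → ℝ} {w₂ : ι₂ → Plane → ℝ} (h₁ : IsEigenfamily P₁ ev₁ w₁)
    (h₂ : IsEigenfamily P₂ ev₂ w₂) (hΩ : IsTwoPieceBand P₁ P₂ Ω) :
    IsFiniteMeasure ((volume : Measure Plane).restrict Ω) ∧
    ∃ b : HilbertBasis (ι₁ ⊕ ι₂) ℝ (L2 Ω), IsDirichletEigenbasis b (Sum.elim ev₁ ev₂) ∧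
      (∀ i, ∫ x in Ω, b (.inl i) x = ∫ x in P₁, w₁ i x) ∧
      ∀ i, ∫ x in Ω, b (.inr i) x = ∫ x in P₂, w₂ i x := by
  obtain ⟨g₁, g₂, hd, rfl⟩ := hΩ
  have h₁' := h₁.image g₁
  have h₂' := h₂.image g₂
  refine ⟨isFiniteMeasure_restrict_of_isBounded (h₁'.isBounded.union h₂'.isBounded), ?_⟩
  obtain ⟨b, hb, hi₁, hi₂⟩ := exists_eigenbasis_union h₁' h₂' hd
  refine ⟨b, hb, fun i => ?_, fun i => ?_⟩
  · rw [hi₁, g₁.setIntegral_image]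
    simp
  · rw [hi₂, g₂.setIntegral_image]
    simp

theorem sum_sq_ge_of_ne {p : TriIndex} (hp : p.1 ≠ (2, 1)) : 10 ≤ p.1.1 ^ 2 + p.1.2 ^ 2 := by
  obtain ⟨⟨m, n⟩, hn, hmn⟩ := p
  simp only [ne_eq, Prod.mk.injEq] at hn hmn hp ⊢
  have hm : 3 ≤ m := by omega
  nlinarith

theorem heatContent_bandA {A : Set Plane} {b : HilbertBasis (RectIndex ⊕ TriIndex) ℝ (L2 A)}
    [IsFiniteMeasure ((volume : Measure Plane).restrict A)]
    (hb : IsDirichletEigenbasis b (Sum.elim (rectEigenvalue 1 1) (triEigenvalue 2)))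
    (hi : ∀ i, ∫ x in A, b (.inr i) x = ∫ x in openRightIsoscelesTriangle 2, triMode 2 i x) :
    (fun t : ℝ => heatContent A t - 1024 / (9 * π ^ 4) * exp (-(5 * π ^ 2 * t / 4)))
      =O[atTop] (fun t : ℝ => exp (-(2 * π ^ 2 * t))) := by
  -- The value 2π² is the first eigenvalue of the unit square; after (2, 1), the triangle modes
  -- start at 10π²/4.
  have h := hb.heatContent_isBigO (.inr ⟨(2, 1), by simp⟩) (μ := 2 * π ^ 2) ?_
  · rw [inner_unitL2, hi, setIntegral_triMode_two_one] at h
    refine h.congr_left fun t => ?_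
    simp only [Sum.elim_inr, triEigenvalue]
    push_cast
    ring_nf
  · rintro (⟨⟨m, n⟩, hm, hn⟩ | i) hne
    · simp only [Sum.elim_inl, rectEigenvalue]
      have h1 : (1 : ℝ) ≤ m := by exact_mod_cast hm
      have h2 : (1 : ℝ) ≤ n := by exact_mod_cast hn
      rw [div_one, div_one, mul_pow, mul_pow, ← add_mul]
      exact mul_le_mul_of_nonneg_right (by nlinarith) (sq_nonneg _)
    · have hp : i.1 ≠ (2, 1) := fun h => hne (congrArg Sum.inr (Subtype.ext h))
      have h1 : (10 : ℝ) ≤ (i.1.1 : ℝ) ^ 2 + (i.1.2 : ℝ) ^ 2 := by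
        exact_mod_cast sum_sq_ge_of_ne hp
      simp only [Sum.elim_inr, triEigenvalue]
      rw [div_pow, div_pow, mul_pow, mul_pow, ← add_div, ← add_mul]
      nlinarith [sq_nonneg π]

theorem heatContent_bandB {B : Set Plane} {b : HilbertBasis (RectIndex ⊕ TriIndex) ℝ (L2 B)}
    [IsFiniteMeasure ((volume : Measure Plane).restrict B)]
    (hb : IsDirichletEigenbasis b (Sum.elim (rectEigenvalue 1 2) (triEigenvalue (√2))))
    (hi : ∀ i, ∫ x in B, b (.inl i) x = ∫ x in openRectangle 1 2, rectMode 1 2 i x) :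
    (fun t : ℝ => heatContent B t - 1152 / (9 * π ^ 4) * exp (-(5 * π ^ 2 * t / 4)))
      =O[atTop] (fun t : ℝ => exp (-(2 * π ^ 2 * t))) := by
  -- The rectangle mode (1, 2) attains 2π². For the triangle the crude bound m² + n² ≥ 4 suffices.
  have h := hb.heatContent_isBigO (.inl ⟨(1, 1), by simp⟩) (μ := 2 * π ^ 2) ?_
  · rw [inner_unitL2, hi, setIntegral_rectMode_one_one] at h
    refine h.congr_left fun t => ?_
    simp only [Sum.elim_inl, rectEigenvalue]
    push_cast
    ring_nf
  · rintro (⟨⟨m, n⟩, hm, hn⟩ | ⟨⟨m, n⟩, hn, hmn⟩) hne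
    · simp only [ne_eq, Sum.inl.injEq, Subtype.mk.injEq, Prod.mk.injEq] at hm hn hne
      simp only [Sum.elim_inl, rectEigenvalue]
      have h1 : 8 ≤ 4 * m ^ 2 + n ^ 2 := by
        rcases (show 2 ≤ m ∨ (m = 1 ∧ 2 ≤ n) by omega) with h | ⟨rfl, h⟩ <;> nlinarith
      have h2 : (8 : ℝ) ≤ 4 * (m : ℝ) ^ 2 + (n : ℝ) ^ 2 := by exact_mod_cast h1
      rw [div_pow, div_pow, mul_pow, mul_pow]
      nlinarith [sq_nonneg π]
    · simp only [Sum.elim_inr, triEigenvalue] at hn hmn ⊢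
      have h1 : 4 ≤ m ^ 2 + n ^ 2 := by nlinarith
      have h2 : (4 : ℝ) ≤ (m : ℝ) ^ 2 + (n : ℝ) ^ 2 := by exact_mod_cast h1
      rw [div_pow, div_pow, mul_pow, mul_pow, Real.sq_sqrt zero_le_two, ← add_div, ← add_mul]
      nlinarith [sq_nonneg π]

/-- Equal heat contents would leave (c₁ - c₂) exp(-lt) = O(exp(-μt)), impossible for l < μ. -/
theorem not_isoheat_of_isBigO {Ω₁ Ω₂ : Set Plane} {c₁ c₂ : ℝ} {l μ : ℝ} (hc : c₁ ≠ c₂) (hl : l < μ)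
    (h₁ : (fun t : ℝ => heatContent Ω₁ t - c₁ * exp (-(l * t))) =O[atTop]
      fun t : ℝ => exp (-(μ * t)))
    (h₂ : (fun t : ℝ => heatContent Ω₂ t - c₂ * exp (-(l * t))) =O[atTop]
      fun t : ℝ => exp (-(μ * t))) : ¬ Isoheat Ω₁ Ω₂ := by
  intro h
  have hlim : Tendsto (fun t : ℝ => -(l * t) - -(μ * t)) atTop atTop := by
    have : (fun t : ℝ => -(l * t) - -(μ * t)) = fun t => (μ - l) * t := by
      ext t
      ring
    rw [this]
    exact tendsto_id.const_mul_atTop (sub_pos.2 hl)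
  have ho := Real.isLittleO_exp_comp_exp_comp.2 hlim
  have hO : (fun t : ℝ => (c₁ - c₂) * exp (-(l * t))) =O[atTop] fun t : ℝ => exp (-(μ * t)) := by
    refine (h₂.sub h₁).congr' ?_ .rfl
    filter_upwards [eventually_gt_atTop 0] with t ht
    rw [h t ht]
    ring
  have := ((isBigO_const_mul_left_iff (sub_ne_zero.2 hc)).1 hO).trans_isLittleO ho
  exact isLittleO_irrefl (.of_forall fun t => (exp_pos _).ne') this

end

theorem theorem1 (A B : Set Plane) (hA : IsChapmanBandA A) (hB : IsChapmanBandB B) :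
    Isospectral A B ∧
    HeatProblemWellPosed A ∧ HeatProblemWellPosed B ∧
    ¬ Isoheat A B ∧
    (fun t : ℝ => heatContent A t - 1024 / (9 * π ^ 4) * exp (-(5 * π ^ 2 * t / 4)))
      =O[atTop] (fun t : ℝ => exp (-(2 * π ^ 2 * t))) ∧
    (fun t : ℝ => heatContent B t - 1152 / (9 * π ^ 4) * exp (-(5 * π ^ 2 * t / 4)))
      =O[atTop] (fun t : ℝ => exp (-(2 * π ^ 2 * t))) := by
  obtain ⟨_, bA, hbA, _, hiA⟩ := exists_eigenbasis_of_isTwoPieceBand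
    (isEigenfamily_rectMode one_pos one_pos) (isEigenfamily_triMode two_pos) hA
  obtain ⟨_, bB, hbB, hiB, _⟩ := exists_eigenbasis_of_isTwoPieceBand
    (isEigenfamily_rectMode one_pos two_pos) (isEigenfamily_triMode (by positivity)) hB
  have hQA := heatContent_bandA hbA hiA
  have hQB := heatContent_bandB hbB hiB
  refine ⟨isospectral_of_equiv hbA hbB (Equiv.ofBijective _ bandIndexMap_bijective)
    eigenvalue_bandIndexMap, hbA.heatProblemWellPosed, hbB.heatProblemWellPosed, ?_, hQA, hQB⟩
  have hexp : ∀ t : ℝ, 5 * π ^ 2 * t / 4 = 5 * π ^ 2 / 4 * t := fun t => by ring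
  simp only [hexp] at hQA hQB
  refine not_isoheat_of_isBigO ?_ ?_ hQA hQB
  · rw [ne_eq, div_left_inj' (by positivity)]
    norm_num
  · nlinarith [sq_pos_of_pos pi_pos]
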